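/- Let $k$ be an algebraically closed field, let $Q$ be a type $\mathbb{A}$ Dynkin quiver (a quiver whose underlying graph is a path on $n\ge 1$ vertices), and let $B=kQ$ be its path algebra, with Jacobson radical $J(B)$ (the ideal generated by the arrows). For vertices $u,v$ write $ukQ_1v$ for the $k$-span of the arrows from $u$ to $v$; if there is at least one such arrow and $U\le ukQ_1v$ is a subspace of codimension $1$, put $$A(u,v,U)=kQ_0\oplus U\oplus\Big(\bigoplus_{(w,y)\ne(u,v)}wkQ_1y\Big)\oplus J(B)^2 .$$ A maximal subalgebra $A\subset B$ is of split type if $(1+x)A(1+x)^{-1}=A(u,v,U)$ for some $x\in J(B)$ and some such $u,v,U$. The Ext quiver of a finite-dimensional basic algebra $A$ has as vertices a complete set $e_1,\dots,e_m$ of primitive orthogonal idempotents of $A$, and $\dim_k e_i\big(J(A)/J(A)^2\big)e_j$ arrows from $e_i$ to $e_j$. Let $A\subset B$ be a maximal subalgebra of split type whose Ext quiver is connected. Then $$\operatorname{Iso}(A,B)=\operatorname{Aut}_k(B)\cdot A ,$$ where $\operatorname{Iso}(A,B)$ is the set of all subalgebras $A'\subset B$ with $\dim_kA'=\dim_kA$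 and $A'\cong A$ as $k$-algebras, and $\operatorname{Aut}_k(B)\cdot A=\{\phi(A) : \phi \text{ a } k\text{-algebra automorphism of } B\}$. -/

import Mathlib

noncomputable section

/-! ### Path algebras -/

/-- The set of all paths of a quiver (a path knows its source and its target; the trivial
path at a vertex is `Quiver.Path.nil`). -/
abbrev AllPaths (V : Type*) [Quiver V] : Type _ := Σ a b : V, Quiver.Path a b

/-- The path algebra `kQ`: the `k`-vector space with basis the set of all paths of `Q`. -/
def PathAlgebra (k : Type*) [Field k] (V : Type*) [Quiver V] : Type _ := AllPaths V →₀ k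

namespace PathAlgebra

variable {k : Type*} [Field k] {V : Type*} [Quiver V]

instance : AddCommGroup (PathAlgebra k V) := inferInstanceAs (AddCommGroup (AllPaths V →₀ k))

instance : Module k (PathAlgebra k V) := inferInstanceAs (Module k (AllPaths V →₀ k))

/-- The basis element of `kQ` given by a path. -/
def ofPath (p : AllPaths V) : PathAlgebra k V := Finsupp.single p (1 : k)

open Classical in
/-- The product of two paths: first `p`, then `q`, if `p` ends where `q` starts; zero otherwise. -/
def pathMul (p q : AllPaths V) : PathAlgebra k V :=
  if h : p.2.1 = q.1 then ofPath ⟨p.1, q.2.1, (p.2.2.cast rfl h).comp q.2.2⟩ else 0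

/-- The linear extension to `kQ` of a map defined on paths. -/
def liftPaths {M : Type*} [AddCommGroup M] [Module k M] (f : AllPaths V → M) :
    PathAlgebra k V →ₗ[k] M :=
  Finsupp.linearCombination k f

theorem liftPaths_ofPath {M : Type*} [AddCommGroup M] [Module k M] (f : AllPaths V → M)
    (p : AllPaths V) : liftPaths f (ofPath p : PathAlgebra k V) = f p :=
  (Finsupp.linearCombination_single k (1 : k) p).trans (one_smul k (f p))

/-- The multiplication of `kQ`: the bilinear extension of the product of paths. -/
def mulHom : PathAlgebra k V →ₗ[k] PathAlgebra k V →ₗ[k] PathAlgebra k V :=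
  liftPaths fun p => liftPaths fun q => pathMul p q

instance : Mul (PathAlgebra k V) := ⟨fun x y => mulHom x y⟩

theorem mul_def (x y : PathAlgebra k V) : x * y = mulHom x y := rfl

theorem ofPath_mul_ofPath (p q : AllPaths V) :
    (ofPath p : PathAlgebra k V) * ofPath q = pathMul p q := by
  rw [mul_def, mulHom, liftPaths_ofPath, liftPaths_ofPath]

theorem ofPath_mul_ofPath_of_comp {a b c : V} (p : Quiver.Path a b) (q : Quiver.Path b c) :
    (ofPath ⟨a, b, p⟩ : PathAlgebra k V) * ofPath ⟨b, c, q⟩ = ofPath ⟨a, c, p.comp q⟩ := by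
  rw [ofPath_mul_ofPath, pathMul, dif_pos rfl]
  rfl

theorem ofPath_mul_ofPath_of_ne {p q : AllPaths V} (h : p.2.1 ≠ q.1) :
    (ofPath p : PathAlgebra k V) * ofPath q = 0 := by
  rw [ofPath_mul_ofPath, pathMul, dif_neg h]

@[elab_as_elim]
theorem induction_on {P : PathAlgebra k V → Prop} (x : PathAlgebra k V)
    (zero : P 0) (add : ∀ x y, P x → P y → P (x + y)) (smul : ∀ (c : k) p, P (c • ofPath p)) :
    P x := by
  refine Finsupp.induction_linear (motive := P) x zero add fun p c => ?_
  have h : (Finsupp.single p c : AllPaths V →₀ k) = c • Finsupp.single p (1 : k) := by simp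
  rw [h]
  exact smul c p

theorem assoc_paths (p q r : AllPaths V) :
    (ofPath p : PathAlgebra k V) * ofPath q * ofPath r = ofPath p * (ofPath q * ofPath r) := by
  have z1 (x : PathAlgebra k V) : (0 : PathAlgebra k V) * x = 0 := by simp [mul_def]
  have z2 (x : PathAlgebra k V) : x * (0 : PathAlgebra k V) = 0 := by simp [mul_def]
  obtain ⟨a, b, p⟩ := p
  obtain ⟨b', c, q⟩ := q
  obtain ⟨c', d, r⟩ := r
  by_cases h : b = b'
  · subst h
    by_cases h' : c = c'
    · subst h'
      simp only [ofPath_mul_ofPath_of_comp, Quiver.Path.comp_assoc]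
    · rw [ofPath_mul_ofPath_of_comp, ofPath_mul_ofPath_of_ne h', ofPath_mul_ofPath_of_ne h', z2]
  · rw [ofPath_mul_ofPath_of_ne h, z1]
    by_cases h' : c = c'
    · subst h'
      rw [ofPath_mul_ofPath_of_comp, ofPath_mul_ofPath_of_ne h]
    · rw [ofPath_mul_ofPath_of_ne h', z2]

instance : NonUnitalRing (PathAlgebra k V) where
  left_distrib x y z := by simp [mul_def]
  right_distrib x y z := by simp [mul_def]
  zero_mul x := by simp [mul_def]
  mul_zero x := by simp [mul_def]
  mul_assoc x y z := by
    have zm (x : PathAlgebra k V) : (0 : PathAlgebra k V) * x = 0 := by simp [mul_def]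
    have mz (x : PathAlgebra k V) : x * (0 : PathAlgebra k V) = 0 := by simp [mul_def]
    have am (x y z : PathAlgebra k V) : (x + y) * z = x * z + y * z := by simp [mul_def]
    have ma (x y z : PathAlgebra k V) : x * (y + z) = x * y + x * z := by simp [mul_def]
    have sm (c : k) (x y : PathAlgebra k V) : (c • x) * y = c • (x * y) := by simp [mul_def]
    have ms (c : k) (x y : PathAlgebra k V) : x * (c • y) = c • (x * y) := by simp [mul_def]
    induction x using induction_on with
    | zero => simp only [zm]
    | add x x' hx hx' => simp only [am, hx, hx']
    | smul c p =>
      induction y using induction_on with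
      | zero => simp only [zm, mz]
      | add y y' hy hy' => simp only [am, ma, hy, hy']
      | smul d q =>
        induction z using induction_on with
        | zero => simp only [mz]
        | add z z' hz hz' => simp only [ma, hz, hz']
        | smul f r => simp only [sm, ms, assoc_paths]

/-- The idempotent of `kQ` given by the trivial path at `v`. -/
def vertex (v : V) : PathAlgebra k V := ofPath ⟨v, v, Quiver.Path.nil⟩

/-- The element of `kQ` given by an arrow. -/
def arrow {u v : V} (f : u ⟶ v) : PathAlgebra k V := ofPath ⟨u, v, f.toPath⟩

theorem vertex_mul_ofPath (p : AllPaths V) :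
    (vertex p.1 : PathAlgebra k V) * ofPath p = ofPath p := by
  obtain ⟨a, b, p⟩ := p
  rw [vertex, ofPath_mul_ofPath_of_comp, Quiver.Path.nil_comp]

theorem vertex_mul_ofPath_of_ne {v : V} {p : AllPaths V} (h : v ≠ p.1) :
    (vertex v : PathAlgebra k V) * ofPath p = 0 :=
  ofPath_mul_ofPath_of_ne h

theorem ofPath_mul_vertex (p : AllPaths V) :
    (ofPath p : PathAlgebra k V) * vertex p.2.1 = ofPath p := by
  obtain ⟨a, b, p⟩ := p
  rw [vertex, ofPath_mul_ofPath_of_comp, Quiver.Path.comp_nil]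

theorem ofPath_mul_vertex_of_ne {v : V} {p : AllPaths V} (h : p.2.1 ≠ v) :
    (ofPath p : PathAlgebra k V) * vertex v = 0 :=
  ofPath_mul_ofPath_of_ne h

section Unital

variable [Fintype V]

/-- The unit of `kQ` is the sum of the trivial paths. -/
instance : One (PathAlgebra k V) := ⟨∑ v, vertex v⟩

theorem one_def : (1 : PathAlgebra k V) = ∑ v, vertex v := rfl

instance : Ring (PathAlgebra k V) where
  __ := (inferInstance : NonUnitalRing (PathAlgebra k V))
  one_mul x := by
    have sm (c : k) (x y : PathAlgebra k V) : x * (c • y) = c • (x * y) := by simp [mul_def]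
    induction x using induction_on with
    | zero => exact mul_zero _
    | add x y hx hy => rw [mul_add, hx, hy]
    | smul c p =>
      rw [sm, one_def, Finset.sum_mul, Finset.sum_eq_single p.1, vertex_mul_ofPath]
      · exact fun v _ h => vertex_mul_ofPath_of_ne h
      · simp
  mul_one x := by
    have sm (c : k) (x y : PathAlgebra k V) : (c • x) * y = c • (x * y) := by simp [mul_def]
    induction x using induction_on with
    | zero => exact zero_mul _
    | add x y hx hy => rw [add_mul, hx, hy]
    | smul c p =>
      rw [sm, one_def, Finset.mul_sum, Finset.sum_eq_single p.2.1, ofPath_mul_vertex]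
      · exact fun v _ h => ofPath_mul_vertex_of_ne h.symm
      · simp

instance : Algebra k (PathAlgebra k V) :=
  Algebra.ofModule (fun c x y => by simp [mul_def]) (fun c x y => by simp [mul_def])

/-! ### The subalgebras `A(u,v,U)` -/

variable (k V) in
/-- `kQ₀`, the span of the vertices. -/
def vertexSpan : Submodule k (PathAlgebra k V) := Submodule.span k (Set.range vertex)

variable (k) in
/-- `ukQ₁v`, the span of the arrows from `u` to `v`. -/
def arrowSpan (u v : V) : Submodule k (PathAlgebra k V) :=
  Submodule.span k (Set.range fun f : u ⟶ v => arrow f)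

variable (k V) in
/-- `J(Q)`, the two-sided ideal of `kQ` generated by all arrows, as a `k`-subspace. (If `Q` is
finite and acyclic, this is the Jacobson radical of `kQ`.) -/
def arrowIdeal : Submodule k (PathAlgebra k V) := ⊤ * (⨆ (u : V) (v : V), arrowSpan k u v) * ⊤

/-- The subspace `kQ₀ ⊕ U ⊕ (⨁_{(w,y) ≠ (u,v)} wkQ₁y) ⊕ J(Q)²` of `kQ`. -/
def splitSubmodule (u v : V) (U : Submodule k (PathAlgebra k V)) :
    Submodule k (PathAlgebra k V) :=
  vertexSpan k V ⊔ U ⊔ (⨆ (w : V) (y : V) (_ : (w, y) ≠ (u, v)), arrowSpan k w y) ⊔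
    arrowIdeal k V ^ 2

theorem arrowSpan_le_arrowIdeal (u v : V) : arrowSpan k u v ≤ arrowIdeal k V := by
  intro x hx
  have h : x ∈ ⨆ (u : V) (v : V), arrowSpan k u v :=
    Submodule.mem_iSup_of_mem u (Submodule.mem_iSup_of_mem v hx)
  simpa [arrowIdeal] using Submodule.mul_mem_mul (Submodule.mul_mem_mul
    (Submodule.mem_top (R := k) (x := (1 : PathAlgebra k V))) h)
    (Submodule.mem_top (R := k) (x := (1 : PathAlgebra k V)))

theorem top_mul_arrowIdeal : ⊤ * arrowIdeal k V ≤ arrowIdeal k V := by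
  unfold arrowIdeal
  rw [← mul_assoc, ← mul_assoc]
  gcongr
  exact le_top

theorem arrowIdeal_mul_top : arrowIdeal k V * ⊤ ≤ arrowIdeal k V := by
  unfold arrowIdeal
  rw [mul_assoc _ ⊤ ⊤]
  gcongr
  exact le_top

theorem vertex_mul_arrowSpan (a u v : V) {x : PathAlgebra k V} (hx : x ∈ arrowSpan k u v) :
    vertex a * x = x ∨ vertex a * x = 0 := by
  by_cases h : a = u
  · left
    subst h
    induction hx using Submodule.span_induction with
    | mem x hx => obtain ⟨f, rfl⟩ := hx; exact vertex_mul_ofPath ⟨a, v, f.toPath⟩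
    | zero => simp
    | add x y _ _ hx hy => rw [mul_add, hx, hy]
    | smul c x _ hx => rw [mul_smul_comm, hx]
  · right
    induction hx using Submodule.span_induction with
    | mem x hx => obtain ⟨f, rfl⟩ := hx; exact vertex_mul_ofPath_of_ne h
    | zero => simp
    | add x y _ _ hx hy => rw [mul_add, hx, hy, add_zero]
    | smul c x _ hx => rw [mul_smul_comm, hx, smul_zero]

theorem arrowSpan_mul_vertex (a u v : V) {x : PathAlgebra k V} (hx : x ∈ arrowSpan k u v) :
    x * vertex a = x ∨ x * vertex a = 0 := by
  by_cases h : v = a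
  · left
    subst h
    induction hx using Submodule.span_induction with
    | mem x hx => obtain ⟨f, rfl⟩ := hx; exact ofPath_mul_vertex ⟨u, v, f.toPath⟩
    | zero => simp
    | add x y _ _ hx hy => rw [add_mul, hx, hy]
    | smul c x _ hx => rw [smul_mul_assoc, hx]
  · right
    induction hx using Submodule.span_induction with
    | mem x hx => obtain ⟨f, rfl⟩ := hx; exact ofPath_mul_vertex_of_ne h
    | zero => simp
    | add x y _ _ hx hy => rw [add_mul, hx, hy, add_zero]
    | smul c x _ hx => rw [smul_mul_assoc, hx, smul_zero]

theorem vertexSpan_mul_le {u v : V} {U : Submodule k (PathAlgebra k V)}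
    (hU : U ≤ arrowSpan k u v) : vertexSpan k V * U ≤ U := by
  rw [Submodule.mul_le]
  intro m hm x hx
  induction hm using Submodule.span_induction with
  | mem m hm =>
    obtain ⟨a, rfl⟩ := hm
    rcases vertex_mul_arrowSpan a u v (hU hx) with h | h <;> rw [h]
    exacts [hx, U.zero_mem]
  | zero => simp
  | add m n _ _ hm hn => rw [add_mul]; exact U.add_mem hm hn
  | smul c m _ hm => rw [smul_mul_assoc]; exact U.smul_mem c hm

theorem mul_vertexSpan_le {u v : V} {U : Submodule k (PathAlgebra k V)}
    (hU : U ≤ arrowSpan k u v) : U * vertexSpan k V ≤ U := by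
  rw [Submodule.mul_le]
  intro x hx m hm
  induction hm using Submodule.span_induction with
  | mem m hm =>
    obtain ⟨a, rfl⟩ := hm
    rcases arrowSpan_mul_vertex a u v (hU hx) with h | h <;> rw [h]
    exacts [hx, U.zero_mem]
  | zero => simp
  | add m n _ _ hm hn => rw [mul_add]; exact U.add_mem hm hn
  | smul c m _ hm => rw [mul_smul_comm]; exact U.smul_mem c hm

theorem vertexSpan_mul_vertexSpan : vertexSpan k V * vertexSpan k V ≤ vertexSpan k V := by
  unfold vertexSpan
  rw [Submodule.span_mul_span, Submodule.span_le]
  rintro _ ⟨_, ⟨a, rfl⟩, _, ⟨b, rfl⟩, rfl⟩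
  by_cases h : a = b
  · subst h
    have h1 : (vertex a * vertex a : PathAlgebra k V) = vertex a :=
      vertex_mul_ofPath ⟨a, a, Quiver.Path.nil⟩
    simpa only [h1] using Submodule.subset_span (Set.mem_range_self a)
  · have h0 : (vertex a * vertex b : PathAlgebra k V) = 0 := vertex_mul_ofPath_of_ne h
    simp [h0]

theorem one_mem_splitSubmodule (u v : V) (U : Submodule k (PathAlgebra k V)) :
    1 ∈ splitSubmodule u v U := by
  have h : (1 : PathAlgebra k V) ∈ vertexSpan k V :=
    Submodule.sum_mem _ fun a _ => Submodule.subset_span ⟨a, rfl⟩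
  exact (le_sup_left.trans (le_sup_left.trans le_sup_left) :
    vertexSpan k V ≤ splitSubmodule u v U) h

theorem splitSubmodule_mul_le {u v : V} {U : Submodule k (PathAlgebra k V)}
    (hU : U ≤ arrowSpan k u v) :
    splitSubmodule u v U * splitSubmodule u v U ≤ splitSubmodule u v U := by
  set K := vertexSpan k V with hK
  set J := arrowIdeal k V with hJ
  set W := U ⊔ ⨆ (w : V) (y : V) (_ : (w, y) ≠ (u, v)), arrowSpan k w y with hW
  have hS : splitSubmodule u v U = K ⊔ W ⊔ J ^ 2 := by
    rw [splitSubmodule, hW, ← sup_assoc]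
  have hWJ : W ≤ J := sup_le (hU.trans (arrowSpan_le_arrowIdeal u v))
    (iSup_le fun w => iSup_le fun y => iSup_le fun _ => arrowSpan_le_arrowIdeal w y)
  have hKW : K * W ≤ W := by
    rw [hW, Submodule.mul_sup]
    simp only [Submodule.mul_iSup]
    exact sup_le_sup (vertexSpan_mul_le hU) (iSup_mono fun w => iSup_mono fun y =>
      iSup_mono fun _ => vertexSpan_mul_le le_rfl)
  have hWK : W * K ≤ W := by
    rw [hW, Submodule.sup_mul]
    simp only [Submodule.iSup_mul]
    exact sup_le_sup (mul_vertexSpan_le hU) (iSup_mono fun w => iSup_mono fun y =>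
      iSup_mono fun _ => mul_vertexSpan_le le_rfl)
  have hT (N : Submodule k (PathAlgebra k V)) : N * J ^ 2 ≤ J ^ 2 := by
    rw [pow_two, ← mul_assoc]
    exact mul_le_mul_left ((mul_le_mul_left le_top J).trans top_mul_arrowIdeal) J
  have hT' (N : Submodule k (PathAlgebra k V)) : J ^ 2 * N ≤ J ^ 2 := by
    rw [pow_two, mul_assoc]
    exact mul_le_mul_right ((mul_le_mul_right le_top J).trans arrowIdeal_mul_top) J
  have hWW : W * W ≤ J ^ 2 := by
    rw [pow_two]
    exact mul_le_mul' hWJ hWJ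
  have a1 : K ≤ K ⊔ W ⊔ J ^ 2 := le_sup_left.trans le_sup_left
  have a2 : W ≤ K ⊔ W ⊔ J ^ 2 := le_sup_right.trans le_sup_left
  have a3 : J ^ 2 ≤ K ⊔ W ⊔ J ^ 2 := le_sup_right
  rw [hS, Submodule.mul_sup _ (K ⊔ W), Submodule.mul_sup, Submodule.sup_mul _ _ K,
    Submodule.sup_mul _ _ W, Submodule.sup_mul _ _ K, Submodule.sup_mul _ _ W]
  exact sup_le (sup_le
    (sup_le (sup_le (vertexSpan_mul_vertexSpan.trans a1) (hWK.trans a2)) ((hT' K).trans a3))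
    (sup_le (sup_le (hKW.trans a2) (hWW.trans a3)) ((hT' W).trans a3))) ((hT _).trans a3)

/-- The subalgebra `A(u,v,U) = kQ₀ ⊕ U ⊕ (⨁_{(w,y) ≠ (u,v)} wkQ₁y) ⊕ J(Q)²` of `kQ`, for a
subspace `U` of `ukQ₁v`. -/
def splitSubalgebra (u v : V) (U : Submodule k (PathAlgebra k V)) (hU : U ≤ arrowSpan k u v) :
    Subalgebra k (PathAlgebra k V) :=
  (splitSubmodule u v U).toSubalgebra (one_mem_splitSubmodule u v U)
    fun _ _ hx hy => splitSubmodule_mul_le hU (Submodule.mul_mem_mul hx hy)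

end Unital

end PathAlgebra

/-! ### Inner automorphisms, isoclasses, subalgebras of split type -/

/-- The inner automorphism `x ↦ c x c⁻¹` of a `k`-algebra given by a unit `c`. -/
def innerAut (k : Type*) [Field k] {B : Type*} [Ring B] [Algebra k B] (c : Bˣ) : B ≃ₐ[k] B where
  toFun x := c * x * ↑c⁻¹
  invFun x := ↑c⁻¹ * x * c
  left_inv x := by simp [mul_assoc]
  right_inv x := by simp [mul_assoc]
  map_mul' x y := by simp [mul_assoc]
  map_add' x y := by simp [mul_add, add_mul]
  commutes' r := by simp [mul_assoc, ← Algebra.commutes r]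

/-- A subalgebra of `kQ` is of split type if some unipotent inner automorphism, i.e. conjugation
by a unit `1 + x` with `x` in the Jacobson radical, carries it to `A(u,v,U)` for some pair of
vertices `u`, `v` with at least one arrow `u ⟶ v` and some subspace `U` of codimension `1`
in `ukQ₁v`. -/
def IsSplitType {k : Type*} [Field k] {V : Type*} [Quiver V] [Fintype V]
    (A : Subalgebra k (PathAlgebra k V)) : Prop :=
  ∃ (u v : V) (U : Submodule k (PathAlgebra k V)) (hU : U ≤ PathAlgebra.arrowSpan k u v)
    (c : (PathAlgebra k V)ˣ),
    Nonempty (u ⟶ v) ∧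
    Module.finrank k U + 1 = Module.finrank k (PathAlgebra.arrowSpan k u v) ∧
    (c : PathAlgebra k V) - 1 ∈ Ring.jacobson (PathAlgebra k V) ∧
    A.map (innerAut k c : PathAlgebra k V →ₐ[k] PathAlgebra k V) =
      PathAlgebra.splitSubalgebra u v U hU

/-- `Iso(A,B)`: the set of all subalgebras of `B` of the same dimension as `A` that are isomorphic
to `A` as `k`-algebras. -/
def isoClass {k : Type*} [Field k] {B : Type*} [Ring B] [Algebra k B] (A : Subalgebra k B) :
    Set (Subalgebra k B) :=
  {A' | Module.finrank k A' = Module.finrank k A ∧ Nonempty (A ≃ₐ[k] A')}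

/-- The orbit of the subalgebra `A` of `B` under the group of all `k`-algebra automorphisms. -/
def autOrbit {k : Type*} [Field k] {B : Type*} [Ring B] [Algebra k B] (A : Subalgebra k B) :
    Set (Subalgebra k B) :=
  {A' | ∃ φ : B ≃ₐ[k] B, A' = A.map (φ : B →ₐ[k] B)}

/-! ### Quivers: underlying graphs, type `𝔸`, Ext quivers -/

/-- A quiver is connected if the graph obtained by forgetting the orientations of its arrows is
connected (loops and multiplicities play no role). -/
def QuiverConnected (V : Type*) [Quiver V] : Prop :=
  (SimpleGraph.fromRel fun a b : V => Nonempty (a ⟶ b)).Connected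

/-- `Q` is a type `𝔸` Dynkin quiver: its underlying graph is the path graph on `n ≥ 1` vertices,
i.e. two vertices that are neighbours in the path are joined by exactly one arrow, in one of the
two directions, and there are no other arrows. -/
def IsTypeA (V : Type*) [Quiver V] : Prop :=
  ∃ (n : ℕ) (e : V ≃ Fin n), 1 ≤ n ∧ ∀ a b : V,
    ((SimpleGraph.pathGraph n).Adj (e a) (e b) → Nonempty (Unique ((a ⟶ b) ⊕ (b ⟶ a)))) ∧
    (¬ (SimpleGraph.pathGraph n).Adj (e a) (e b) → IsEmpty (a ⟶ b))

section ExtQuiver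

variable (k : Type*) [Field k] {A : Type*} [Ring A] [Algebra k A]

/-- An idempotent is primitive if it is nonzero and not the sum of two nonzero orthogonal
idempotents. -/
def IsPrimitiveIdempotent {A : Type*} [Ring A] (e : A) : Prop :=
  IsIdempotentElem e ∧ e ≠ 0 ∧ ∀ f g : A, IsIdempotentElem f → IsIdempotentElem g →
    f * g = 0 → g * f = 0 → e = f + g → f = 0 ∨ g = 0

variable (A) in
/-- The Jacobson radical of `A` as a `k`-subspace. -/
def jacobsonSubspace : Submodule k A := (Ring.jacobson A).restrictScalars k

/-- The subspace `e (J / J²) f` of `A / J²`, where `J` is the Jacobson radical of `A`. -/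
def radicalLayer (e f : A) : Submodule k (A ⧸ jacobsonSubspace k A ^ 2) :=
  (jacobsonSubspace k A).map ((jacobsonSubspace k A ^ 2).mkQ ∘ₗ LinearMap.mulLeft k e ∘ₗ LinearMap.mulRight k f)

/-- The Ext quiver (ordinary quiver) of a finite-dimensional basic algebra `A` with respect to a
complete family `e` of primitive orthogonal idempotents: its vertices are the indices of the
family, and there are `dim_k e_i (J / J²) e_j` arrows from `i` to `j`. -/
def ExtQuiver (_k : Type*) {A ι : Type*} (_e : ι → A) : Type _ := ι

instance {ι : Type*} (e : ι → A) : Quiver (ExtQuiver k e) where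
  Hom i j := Fin (Module.finrank k (radicalLayer k (e i) (e j)))

variable (A) in
/-- The Ext quiver of `A` is connected. (Up to isomorphism the Ext quiver of a basic algebra does
not depend on the chosen complete family of primitive orthogonal idempotents.) -/
def HasConnectedExtQuiver : Prop :=
  ∃ (m : ℕ) (e : Fin m → A), CompleteOrthogonalIdempotents e ∧
    (∀ i, IsPrimitiveIdempotent (e i)) ∧ QuiverConnected (ExtQuiver k e)

end ExtQuiver

end

/-! Since `Q` is a path, `kQ` is the incidence algebra of a poset on the vertices, where `x < y`
means that all edges between them point from `x` to `y`; `isIncidenceRep_toMatrix` realises it by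
matrices. There is at most one arrow from `u` to `v`, so `U = 0` and `A(u,v,U)` consists of the
elements with vanishing `(u, v)` entry (`mem_splitSubalgebra_iff`). It is the incidence algebra of
the order with the covering pair `u < v` deleted.

Let `A'` be isomorphic to it. The images of the standard idempotents are a complete orthogonal
family of `|V|` nonzero idempotents of `kQ`, so some conjugate of `A'` contains the standard ones
(`IsIncidenceRep.exists_conj`) and is the incidence algebra of a subrelation. Counting shows that
this subrelation misses one pair `(p, q)`, and transitivity makes that pair a cover.

The rest is combinatorics (`exists_aut_of_cut_iso`): if deleting `(u, v)` and deleting `(p, q)` give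
isomorphic connected orders, then an automorphism of the whole order carries one pair to the other,
and it induces an automorphism of `kQ`. Connectedness excludes that `u` is minimal and `v` maximal,
when the deletion splits the path. If `u` is not minimal and `v` not maximal, the isomorphism
matches the pairs up to exchanging `u` and `v`. If `v` is maximal, `u` becomes a leaf hanging off
its other neighbour, and without this leaf the covers form a line, which allows only the identity
and the reflection. The case of minimal `u` is dual. -/

/-! ### Path orders, and cuts with elements on both sides. -/

/-- A strict order on a set of vertices placed at the points `0, …, m` of a line, which arises from
an orientation of the edges of this line: `x` is below `y` if all edges between them point
from `x` to `y`. -/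
structure IsPathOrder {V : Type*} (lt : V → V → Prop) (pos : V → ℤ) (m : ℤ) : Prop where
  irrefl : ∀ x, ¬ lt x x
  trans : ∀ {x y z}, lt x y → lt y z → lt x z
  inj : ∀ {x y}, pos x = pos y → x = y
  nonneg : ∀ x, 0 ≤ pos x
  le : ∀ x, pos x ≤ m
  surj : ∀ i, 0 ≤ i → i ≤ m → ∃ x, pos x = i
  adj : ∀ {x y}, pos y = pos x + 1 → lt x y ∨ lt y x
  between : ∀ {x y z}, lt x z → lt z y →
    (pos x < pos z ∧ pos z < pos y) ∨ (pos y < pos z ∧ pos z < pos x)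
  conv : ∀ {x y z}, lt x y →
    (pos x < pos z ∧ pos z < pos y) ∨ (pos y < pos z ∧ pos z < pos x) → lt x z ∧ lt z y

/-- The relation `lt` without the pair `(u, v)`. -/
def cutRel {V : Type*} (lt : V → V → Prop) (u v x y : V) : Prop := lt x y ∧ ¬ (x = u ∧ y = v)

namespace IsPathOrder

variable {V : Type*} {lt : V → V → Prop} {pos : V → ℤ} {m : ℤ}

theorem rev (h : IsPathOrder lt pos m) : IsPathOrder lt (fun x => m - pos x) m where
  irrefl := h.irrefl
  trans := h.trans
  inj hxy := h.inj (by linarith)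
  nonneg x := by linarith [h.le x]
  le x := by linarith [h.nonneg x]
  surj i h0 h1 := by
    obtain ⟨x, hx⟩ := h.surj (m - i) (by linarith) (by linarith)
    exact ⟨x, by linarith⟩
  adj hxy := (h.adj (by linarith)).symm
  between h1 h2 := by
    rcases h.between h1 h2 with h | h
    · right; constructor <;> linarith
    · left; constructor <;> linarith
  conv h1 h2 := h.conv h1 (by
    rcases h2 with h2 | h2
    · right; constructor <;> linarith
    · left; constructor <;> linarith)

theorem dual (h : IsPathOrder lt pos m) : IsPathOrder (fun x y => lt y x) pos m where
  irrefl := h.irrefl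
  trans h1 h2 := h.trans h2 h1
  inj := h.inj
  nonneg := h.nonneg
  le := h.le
  surj := h.surj
  adj hxy := (h.adj hxy).symm
  between h1 h2 := (h.between h2 h1).symm
  conv h1 h2 := (h.conv h1 h2.symm).symm

theorem asymm (h : IsPathOrder lt pos m) {x y : V} (h1 : lt x y) (h2 : lt y x) : False :=
  h.irrefl x (h.trans h1 h2)

/-- Otherwise the neighbour of `u` on the way to `v` lies strictly between them, by `conv`. -/
theorem adj_of_cover (h : IsPathOrder lt pos m) {u v : V} (huv : lt u v)
    (hcov : ∀ z, ¬ (lt u z ∧ lt z v)) : pos v = pos u + 1 ∨ pos v = pos u - 1 := by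
  have hne : pos u ≠ pos v := fun e => h.irrefl u (by rwa [← h.inj e] at huv)
  by_contra hcon
  push Not at hcon
  have := h.nonneg u
  have := h.nonneg v
  have := h.le u
  have := h.le v
  rcases lt_or_gt_of_ne hne with h1 | h1
  · obtain ⟨z, hz⟩ := h.surj (pos u + 1) (by omega) (by omega)
    exact hcov z (h.conv huv (by omega))
  · obtain ⟨z, hz⟩ := h.surj (pos u - 1) (by omega) (by omega)
    exact hcov z (h.conv huv (by omega))

theorem lt_iff_of_map_cut {σ : V ≃ V} {u v u' v' : V} (huv : lt u v) (huv' : lt u' v')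
    (hσ : ∀ x y, cutRel lt u v x y ↔ cutRel lt u' v' (σ x) (σ y))
    (hu : σ u = u') (hv : σ v = v') (x y : V) : lt x y ↔ lt (σ x) (σ y) := by
  by_cases hxy : x = u ∧ y = v
  · obtain ⟨rfl, rfl⟩ := hxy
    simp [hu, hv, huv, huv']
  · have := hσ x y
    have h2 : ¬ (σ x = u' ∧ σ y = v') := by
      rw [← hu, ← hv]
      simpa using hxy
    simpa [cutRel, hxy, h2] using this

/-- By `between`, both `u` and `x` lie on the side of `v` away from `b`. As `u` is the vertex next
to `v` there, it sits between `x` and `v`. -/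
theorem lt_of_cover_of_lt (h : IsPathOrder lt pos m) {u v b x : V} (huv : lt u v)
    (hadj : pos v = pos u + 1 ∨ pos v = pos u - 1) (hvb : lt v b) (hxv : lt x v) (hx : x ≠ u) :
    lt x u := by
  have h1 := h.between huv hvb
  have h2 := h.between hxv hvb
  have h3 : pos x ≠ pos u := fun e => hx (h.inj e)
  exact (h.conv hxv (by omega)).1

/-- Both elements lie on the segment from `z` to `t`, all of whose edges point the same way. -/
theorem comparable_of_bounds (h : IsPathOrder lt pos m) {x y z t : V} (h1 : lt z x) (h2 : lt z y)
    (h3 : lt x t) (h4 : lt y t) (hne : x ≠ y) : lt x y ∨ lt y x := by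
  have a1 := h.between h1 h3
  have a2 := h.between h2 h4
  have a3 : pos x ≠ pos y := fun e => hne (h.inj e)
  by_cases h5 : (pos z < pos y ∧ pos y < pos x) ∨ (pos x < pos y ∧ pos y < pos z)
  · exact Or.inr (h.conv h1 h5).2
  · exact Or.inl (h.conv h3 (by omega)).1

/-- `σ u` and `σ v` keep a common lower and a common upper bound, so they are comparable in the full
order; in the cut order they are not. Hence they are `u'` and `v'` in some order. -/
theorem exists_aut_of_interior (h : IsPathOrder lt pos m) {u v u' v' a b : V}
    (huv : lt u v) (hcov : ∀ z, ¬ (lt u z ∧ lt z v)) (huv' : lt u' v')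
    (hau : lt a u) (hvb : lt v b) (σ : V ≃ V)
    (hσ : ∀ x y, cutRel lt u v x y ↔ cutRel lt u' v' (σ x) (σ y)) :
    ∃ τ : V ≃ V, (∀ x y, lt x y ↔ lt (τ x) (τ y)) ∧ τ u = u' ∧ τ v = v' := by
  classical
  have hne : u ≠ v := fun e => h.irrefl u (by rwa [← e] at huv)
  have hadj := h.adj_of_cover huv hcov
  have ha : a ≠ u := fun e => h.irrefl u (by rwa [e] at hau)
  have hb : b ≠ v := fun e => h.irrefl v (by rwa [e] at hvb)
  have c1 := ((hσ a u).1 ⟨hau, fun e => ha e.1⟩).1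
  have c2 := ((hσ a v).1 ⟨h.trans hau huv, fun e => ha e.1⟩).1
  have c3 := ((hσ u b).1 ⟨h.trans huv hvb, fun e => hb e.2⟩).1
  have c4 := ((hσ v b).1 ⟨hvb, fun e => hb e.2⟩).1
  have n1 : ¬ cutRel lt u' v' (σ u) (σ v) := by
    rw [← hσ]
    exact fun e => e.2 ⟨rfl, rfl⟩
  have n2 : ¬ cutRel lt u' v' (σ v) (σ u) := by
    rw [← hσ]
    exact fun e => h.asymm huv e.1
  rcases h.comparable_of_bounds c1 c2 c3 c4 (σ.injective.ne hne) with c | c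
  · have e : σ u = u' ∧ σ v = v' := by
      by_contra e
      exact n1 ⟨c, e⟩
    exact ⟨σ, lt_iff_of_map_cut huv huv' hσ e.1 e.2, e⟩
  · have e : σ v = u' ∧ σ u = v' := by
      by_contra e
      exact n2 ⟨c, e⟩
    -- Apart from each other, `u` and `v` have the same elements below and above, so exchanging them
    -- is an automorphism of the cut order. It corrects the reversed matching.
    have d1 (x : V) (hx : x ≠ u) (hx' : x ≠ v) : lt x u ↔ lt x v :=
      ⟨fun k => h.trans k huv, fun k => h.lt_of_cover_of_lt huv hadj hvb k hx⟩
    have d2 (x : V) (hx : x ≠ u) (hx' : x ≠ v) : lt u x ↔ lt v x :=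
      ⟨fun k => h.dual.lt_of_cover_of_lt (x := x) huv (by omega) hau k hx', fun k => h.trans huv k⟩
    have hvu : ¬ lt v u := fun k => h.asymm huv k
    have hs (x y : V) : cutRel lt u v x y ↔
        cutRel lt u v (Equiv.swap u v x) (Equiv.swap u v y) := by
      by_cases x1 : x = u
      · subst x1
        by_cases y1 : y = x
        · subst y1; simp [cutRel, h.irrefl]
        · by_cases y2 : y = v
          · subst y2; simp [cutRel, hvu]
          · simp [cutRel, Equiv.swap_apply_of_ne_of_ne y1 y2, d2 y y1 y2, y2]
      · by_cases x2 : x = v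
        · subst x2
          by_cases y1 : y = u
          · subst y1; simp [cutRel, hvu]
          · by_cases y2 : y = x
            · subst y2; simp [cutRel, h.irrefl]
            · simp [cutRel, Equiv.swap_apply_of_ne_of_ne y1 y2, d2 y y1 y2, y2]
        · rw [Equiv.swap_apply_of_ne_of_ne x1 x2]
          by_cases y1 : y = u
          · subst y1; simp [cutRel, d1 x x1 x2, x1]
          · by_cases y2 : y = v
            · subst y2; simp [cutRel, d1 x x1 x2, x1]
            · simp [cutRel, Equiv.swap_apply_of_ne_of_ne y1 y2]
    refine ⟨(Equiv.swap u v).trans σ, lt_iff_of_map_cut huv huv' (fun x y => ?_) ?_ ?_, ?_, ?_⟩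
    · rw [hs, hσ]; rfl
    all_goals simp [e]

end IsPathOrder

/-! ### Rigidity of a line. -/

/-- An injective self-map of `0, …, N` that moves neighbours to neighbours is the identity or
the reflection. -/
theorem eq_id_or_reflection {N : ℤ} (g : ℤ → ℤ) (h0 : ∀ i, 0 ≤ i → i ≤ N → 0 ≤ g i)
    (hN : ∀ i, 0 ≤ i → i ≤ N → g i ≤ N)
    (hinj : ∀ i j, 0 ≤ i → i ≤ N → 0 ≤ j → j ≤ N → g i = g j → i = j)
    (hadj : ∀ i, 0 ≤ i → i < N → g (i + 1) = g i + 1 ∨ g (i + 1) = g i - 1) :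
    (∀ i, 0 ≤ i → i ≤ N → g i = i) ∨ (∀ i, 0 ≤ i → i ≤ N → g i = N - i) := by
  -- A change of direction would give `g (n + 2) = g n`, against injectivity; so all increments
  -- equal the first one.
  have step (n : ℕ) (d : ℤ) (hd : g 1 = g 0 + d) (hn : (n : ℤ) + 1 ≤ N) :
      g n = g 0 + d * n ∧ g (n + 1) = g 0 + d * (n + 1) := by
    induction n with
    | zero => simp [hd]
    | succ n ih =>
      push_cast at hn ⊢
      obtain ⟨i1, i2⟩ := ih (by omega)
      refine ⟨i2, ?_⟩
      have a1 := hadj n (by omega) (by omega)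
      have a2 := hadj (n + 1) (by omega) (by omega)
      have a3 := hinj n (n + 1 + 1) (by omega) (by omega) (by omega) (by omega)
      rw [mul_add, mul_one] at *
      rw [mul_add, mul_one]
      omega
  rcases lt_or_ge N 0 with hneg | hpos
  · left; intro i _ _; omega
  rcases hpos.eq_or_lt with rfl | hpos
  · left
    intro i hi hi'
    have := h0 i hi hi'
    have := hN i hi hi'
    omega
  have hform (d : ℤ) (hd : g 1 = g 0 + d) (i : ℤ) (hi : 0 ≤ i) (hiN : i ≤ N) :
      g i = g 0 + d * i := by
    lift i to ℕ using hi
    rcases Nat.eq_zero_or_pos i with rfl | hi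
    · simp
    · obtain ⟨j, rfl⟩ := Nat.exists_eq_add_of_le' hi
      exact_mod_cast (step j d hd (by exact_mod_cast hiN)).2
  have b0 := h0 0 le_rfl hpos.le
  have bN := hN 0 le_rfl hpos.le
  have c0 := h0 N hpos.le le_rfl
  have cN := hN N hpos.le le_rfl
  -- The slope is `1` or `-1`, and the bounds at `0` and `N` then determine `g 0`.
  rcases hadj 0 le_rfl hpos with h | h
  · left
    intro i hi hiN
    have f1 := hform 1 h i hi hiN
    have f2 := hform 1 h N hpos.le le_rfl
    omega
  · right
    intro i hi hiN
    have f1 := hform (-1) h i hi hiN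
    have f2 := hform (-1) h N hpos.le le_rfl
    omega

/-! ### Cuts below a maximal vertex. -/

/-- Three consecutive points `a < u < v` of a path order, of which `v` is maximal. -/
structure IsSinkCut {V : Type*} (lt : V → V → Prop) (pos : V → ℤ) (a u v : V) : Prop where
  lt_left : lt a u
  lt_right : lt u v
  pos_eq : (pos u = pos a + 1 ∧ pos v = pos a + 2) ∨ (pos u = pos a - 1 ∧ pos v = pos a - 2)
  max : ∀ y, ¬ lt v y

/-- `y` is the only lower cover of `z`. -/
def IsUniqueLowerCover {V : Type*} (R : V → V → Prop) (y z : V) : Prop :=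
  ∀ x, R x z ↔ x = y ∨ R x y

/-- `y` covers `x` in the relation `R`. -/
def IsCover {V : Type*} (R : V → V → Prop) (x y : V) : Prop := R x y ∧ ∀ z, ¬ (R x z ∧ R z y)

theorem IsUniqueLowerCover.map {V : Type*} {R R' : V → V → Prop} {σ : V ≃ V}
    (hσ : ∀ x y, R x y ↔ R' (σ x) (σ y)) {y z : V} (h : IsUniqueLowerCover R y z) :
    IsUniqueLowerCover R' (σ y) (σ z) := by
  intro x
  have := h (σ.symm x)
  rwa [hσ, hσ, Equiv.apply_symm_apply, Equiv.symm_apply_eq] at this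

theorem IsCover.map {V : Type*} {R R' : V → V → Prop} {σ : V ≃ V}
    (hσ : ∀ x y, R x y ↔ R' (σ x) (σ y)) {y z : V} (h : IsCover R y z) :
    IsCover R' (σ y) (σ z) := by
  refine ⟨(hσ _ _).1 h.1, fun x hx => h.2 (σ.symm x) ?_⟩
  rwa [hσ, hσ, Equiv.apply_symm_apply]

theorem map_symm_iff {V : Type*} {R R' : V → V → Prop} {σ : V ≃ V}
    (hσ : ∀ x y, R x y ↔ R' (σ x) (σ y)) (x y : V) : R' x y ↔ R (σ.symm x) (σ.symm y) := by
  rw [hσ, Equiv.apply_symm_apply, Equiv.apply_symm_apply]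

namespace IsPathOrder

variable {V : Type*} {lt : V → V → Prop} {pos : V → ℤ} {m : ℤ}

theorem cut_asymm (h : IsPathOrder lt pos m) {u v x y : V} (h1 : cutRel lt u v x y)
    (h2 : cutRel lt u v y x) : False := h.asymm h1.1 h2.1

theorem lowerCover_unique (h : IsPathOrder lt pos m) {u v y y' z : V}
    (h1 : IsUniqueLowerCover (cutRel lt u v) y z) (h2 : IsUniqueLowerCover (cutRel lt u v) y' z) :
    y = y' := by
  rcases (h1 y').1 ((h2 y').2 (Or.inl rfl)) with e | e
  · exact e.symm
  rcases (h2 y).1 ((h1 y).2 (Or.inl rfl)) with e' | e'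
  · exact e'
  · exact (h.cut_asymm e e').elim

theorem not_mid (h : IsPathOrder lt pos m) {x y z : V} (h1 : lt x z) (h2 : lt z y)
    (hadj : pos y = pos x + 1 ∨ pos y = pos x - 1) : False := by
  have := h.between h1 h2
  omega

end IsPathOrder

namespace IsSinkCut

variable {V : Type*} {lt : V → V → Prop} {pos : V → ℤ} {m : ℤ} {a u v a' u' v' : V}

theorem rev (c : IsSinkCut lt pos a u v) : IsSinkCut lt (fun x => m - pos x) a u v where
  lt_left := c.lt_left
  lt_right := c.lt_right
  pos_eq := by have := c.pos_eq; omega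
  max := c.max

theorem ne_au (h : IsPathOrder lt pos m) (c : IsSinkCut lt pos a u v) : a ≠ u :=
  fun e => h.irrefl u (e ▸ c.lt_left)

theorem ne_uv (h : IsPathOrder lt pos m) (c : IsSinkCut lt pos a u v) : u ≠ v :=
  fun e => h.irrefl v (e ▸ c.lt_right)

theorem ne_av (h : IsPathOrder lt pos m) (c : IsSinkCut lt pos a u v) : a ≠ v :=
  fun e => h.asymm (e ▸ c.lt_left) c.lt_right

/-- `a < u < y` puts `y` on the side of `v`; past `v` it would lie above the maximal `v`. -/
theorem eq_of_lt (h : IsPathOrder lt pos m) (c : IsSinkCut lt pos a u v) {y : V} (hy : lt u y) :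
    y = v := by
  by_contra hne
  have p1 : pos y ≠ pos v := fun e => hne (h.inj e)
  have p2 := h.between c.lt_left hy
  have p3 := c.pos_eq
  exact c.max y (h.conv hy (by omega)).2

theorem cut_max (h : IsPathOrder lt pos m) (c : IsSinkCut lt pos a u v) (y : V) :
    ¬ cutRel lt u v u y :=
  fun e => e.2 ⟨rfl, c.eq_of_lt h e.1⟩

theorem lt_iff (h : IsPathOrder lt pos m) (c : IsSinkCut lt pos a u v) (x : V) :
    lt x u ↔ x = a ∨ lt x a := by
  constructor
  · intro hx
    by_cases e : x = a
    · exact Or.inl e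
    · right
      have p1 : pos x ≠ pos a := fun k => e (h.inj k)
      have p2 := h.between hx c.lt_right
      have p3 := c.pos_eq
      exact (h.conv hx (by omega)).1
  · rintro (rfl | hx)
    · exact c.lt_left
    · exact h.trans hx c.lt_left

theorem lowerCover (h : IsPathOrder lt pos m) (c : IsSinkCut lt pos a u v) :
    IsUniqueLowerCover (cutRel lt u v) a u := by
  intro x
  simp [cutRel, c.ne_uv h, c.ne_av h, c.lt_iff h]

theorem cover_left (h : IsPathOrder lt pos m) (c : IsSinkCut lt pos a u v) :
    IsCover (cutRel lt u v) a u := by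
  refine ⟨⟨c.lt_left, fun e => c.ne_au h e.1⟩, fun z hz => h.not_mid hz.1.1 hz.2.1 ?_⟩
  have := c.pos_eq
  omega

/-- With `u` no longer below `v`, nothing is left between `a` and `v`. This new cover closes the gap
that `u` leaves in the line. -/
theorem cover_right (h : IsPathOrder lt pos m) (c : IsSinkCut lt pos a u v) :
    IsCover (cutRel lt u v) a v := by
  refine ⟨⟨h.trans c.lt_left c.lt_right, fun e => c.ne_au h e.1⟩, fun z hz => ?_⟩
  have p1 := h.between hz.1.1 hz.2.1
  have p2 := c.pos_eq
  exact hz.2.2 ⟨h.inj (by omega), rfl⟩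

/-- Covers in the cut order are neighbours on the line, or the two ends of the cut triple. -/
theorem cover_adj (h : IsPathOrder lt pos m) (c : IsSinkCut lt pos a u v) {x y : V}
    (hc : IsCover (cutRel lt u v) x y) :
    (pos y = pos x + 1 ∨ pos y = pos x - 1) ∨ (x = a ∧ y = v) := by
  obtain ⟨⟨hxy, hn⟩, hc⟩ := hc
  by_contra hcon
  push Not at hcon
  obtain ⟨⟨n1, n2⟩, n3⟩ := hcon
  have hne : pos x ≠ pos y := fun e => h.irrefl x (by rwa [← h.inj e] at hxy)
  have b1 := h.nonneg x
  have b2 := h.nonneg y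
  have b3 := h.le x
  have b4 := h.le y
  obtain ⟨z, hz, hz'⟩ : ∃ z, (pos z = pos x + 1 ∨ pos z = pos x - 1) ∧
      ((pos x < pos z ∧ pos z < pos y) ∨ (pos y < pos z ∧ pos z < pos x)) := by
    rcases lt_or_gt_of_ne hne with h1 | h1
    · obtain ⟨z, hz⟩ := h.surj (pos x + 1) (by omega) (by omega)
      exact ⟨z, by omega, by omega⟩
    · obtain ⟨z, hz⟩ := h.surj (pos x - 1) (by omega) (by omega)
      exact ⟨z, by omega, by omega⟩
  obtain ⟨l1, l2⟩ := h.conv hxy hz'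
  -- The neighbour `z` of `x` towards `y` is between them in the full order. The deleted pair could
  -- be `(x, z)`, against the maximality of `v`, or `(z, y)`, which forces `x = a`.
  refine hc z ⟨⟨l1, ?_⟩, l2, ?_⟩
  · rintro ⟨rfl, rfl⟩
    exact c.max y l2
  · rintro ⟨rfl, rfl⟩
    refine n3 (h.inj ?_) rfl
    have := c.pos_eq
    omega

/-- The coordinate of a vertex after the vertex at position `q` has been removed. -/
def skip (q p : ℤ) : ℤ := if p < q then p else p - 1

/-- Without the leaf `u`, the covers of the cut order form a line with coordinates `0, …, m - 1`
given by `skip`, in which `a` and `v` are neighbours. As `σ` preserves covers, `eq_id_or_reflection`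
applies. -/
theorem reflection_of_fix (h : IsPathOrder lt pos m) (c : IsSinkCut lt pos a u v)
    (c' : IsSinkCut lt pos a' u' v') {σ : V ≃ V}
    (hσ : ∀ x y, cutRel lt u v x y ↔ cutRel lt u' v' (σ x) (σ y)) (hu : σ u = u') :
    (∀ x, x ≠ u → skip (pos u') (pos (σ x)) = skip (pos u) (pos x)) ∨
    (∀ x, x ≠ u → skip (pos u') (pos (σ x)) = m - 1 - skip (pos u) (pos x)) := by
  have : Nonempty V := ⟨u⟩
  choose! X hX using h.surj
  have bu := h.nonneg u
  have bu' := h.le u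
  have bw := h.nonneg u'
  have bw' := h.le u'
  -- The vertex with `skip` coordinate `i`.
  let X' : ℤ → V := fun i => X (if i < pos u then i else i + 1)
  have hX' (i : ℤ) (h0 : 0 ≤ i) (h1 : i ≤ m - 1) :
      (pos (X' i) = i ∧ i < pos u) ∨ (pos (X' i) = i + 1 ∧ pos u ≤ i) := by
    simp only [X']
    split_ifs with hi
    · exact Or.inl ⟨hX i (by omega) (by omega), hi⟩
    · exact Or.inr ⟨hX (i + 1) (by omega) (by omega), by omega⟩
  have hXu (i : ℤ) (h0 : 0 ≤ i) (h1 : i ≤ m - 1) : X' i ≠ u := by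
    intro e
    have := hX' i h0 h1
    rw [e] at this
    omega
  have hne {x : V} (hx : x ≠ u) : pos (σ x) ≠ pos u' := by
    intro e
    exact hx (σ.injective (by rw [hu, h.inj e]))
  have key := eq_id_or_reflection (N := m - 1) (fun i => skip (pos u') (pos (σ (X' i)))) ?_ ?_ ?_ ?_
  · have tr (x : V) (hx : x ≠ u) : 0 ≤ skip (pos u) (pos x) ∧ skip (pos u) (pos x) ≤ m - 1 ∧
        X' (skip (pos u) (pos x)) = x := by
      have p1 := h.nonneg x
      have p2 := h.le x
      have p3 : pos x ≠ pos u := fun e => hx (h.inj e)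
      have p4 : 0 ≤ skip (pos u) (pos x) ∧ skip (pos u) (pos x) ≤ m - 1 := by
        unfold skip; split_ifs <;> omega
      refine ⟨p4.1, p4.2, h.inj ?_⟩
      have := hX' _ p4.1 p4.2
      unfold skip at *
      split_ifs at * <;> omega
    refine key.imp (fun k x hx => ?_) (fun k x hx => ?_)
    all_goals
      obtain ⟨t0, t1, t2⟩ := tr x hx
      have := k _ t0 t1
      simpa only [t2] using this
  · intro i hi hi'
    have p1 := h.nonneg (σ (X' i))
    have p2 := hne (hXu i hi hi')
    simp only [skip]
    split_ifs <;> omega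
  · intro i hi hi'
    have p1 := h.le (σ (X' i))
    have p2 := hne (hXu i hi hi')
    simp only [skip]
    split_ifs <;> omega
  · intro i j hi hi' hj hj' hij
    have p1 := hne (hXu i hi hi')
    have p2 := hne (hXu j hj hj')
    have e : X' i = X' j := by
      apply σ.injective
      apply h.inj
      simp only [skip] at hij
      split_ifs at hij <;> omega
    have p3 := hX' i hi hi'
    have p4 := hX' j hj hj'
    rw [e] at p3
    omega
  · intro i hi hi'
    have x1 := hX' i hi (by omega)
    have x2 := hX' (i + 1) (by omega) (by omega)
    have n1 := hne (hXu i hi (by omega))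
    have n2 := hne (hXu (i + 1) (by omega) (by omega))
    have cov : IsCover (cutRel lt u v) (X' i) (X' (i + 1)) ∨
        IsCover (cutRel lt u v) (X' (i + 1)) (X' i) := by
      have m1 := hXu i hi (by omega)
      have m2 := hXu (i + 1) (by omega) (by omega)
      by_cases e : pos (X' (i + 1)) = pos (X' i) + 1
      · refine (h.adj e).imp (fun l => ⟨⟨l, fun k => m1 k.1⟩, fun z hz => ?_⟩)
          (fun l => ⟨⟨l, fun k => m2 k.1⟩, fun z hz => ?_⟩)
        · exact h.not_mid hz.1.1 hz.2.1 (by omega)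
        · exact h.not_mid hz.1.1 hz.2.1 (by omega)
      -- The positions jump over `u`, so the two vertices are `a` and `v`.
      · rcases c.pos_eq with pe | pe
        · left
          rw [h.inj (show pos (X' i) = pos a by omega),
            h.inj (show pos (X' (i + 1)) = pos v by omega)]
          exact c.cover_right h
        · right
          rw [h.inj (show pos (X' i) = pos v by omega),
            h.inj (show pos (X' (i + 1)) = pos a by omega)]
          exact c.cover_right h
    have fin {x y : V} (hx : pos x ≠ pos u') (hy : pos y ≠ pos u')
        (hc : IsCover (cutRel lt u' v') x y) :
        skip (pos u') (pos y) = skip (pos u') (pos x) + 1 ∨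
        skip (pos u') (pos y) = skip (pos u') (pos x) - 1 := by
      have q := c'.pos_eq
      rcases c'.cover_adj h hc with e | ⟨rfl, rfl⟩
      · unfold skip; split_ifs <;> omega
      · unfold skip; split_ifs <;> omega
    rcases cov with cov | cov
    · exact fin n1 n2 (cov.map hσ)
    · have := fin n2 n1 (cov.map hσ)
      omega

/-- Suppose `σ v ≠ v'`. Since `σ a = a'`, the coordinates of `a`, `v` and their images leave only a
reflection with `a'`, `u'`, `v'` also running rightwards; any other case forces `σ v = v'` or makes
the edge between `a` and `u` point both ways. -/
theorem exists_aut_of_fix_right (h : IsPathOrder lt pos m) (c : IsSinkCut lt pos a u v)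
    (c' : IsSinkCut lt pos a' u' v') {σ : V ≃ V}
    (hσ : ∀ x y, cutRel lt u v x y ↔ cutRel lt u' v' (σ x) (σ y)) (hu : σ u = u')
    (hpos : pos u = pos a + 1 ∧ pos v = pos a + 2) :
    ∃ τ : V ≃ V, (∀ x y, lt x y ↔ lt (τ x) (τ y)) ∧ τ u = u' ∧ τ v = v' := by
  by_cases hv : σ v = v'
  · exact ⟨σ, IsPathOrder.lt_iff_of_map_cut c.lt_right c'.lt_right hσ hu hv, hu, hv⟩
  have ha : σ a = a' := by
    have := (c.lowerCover h).map hσ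
    rw [hu] at this
    exact h.lowerCover_unique this (c'.lowerCover h)
  have hne {x : V} (hx : x ≠ u) : pos (σ x) ≠ pos u' := by
    intro e
    exact hx (σ.injective (by rw [hu, h.inj e]))
  have hua : ¬ lt u a := fun e => h.asymm e c.lt_left
  have hva : pos (σ v) ≠ pos v' := fun e => hv (h.inj e)
  have n1 := hne (c.ne_au h)
  have n2 := hne (c.ne_uv h).symm
  rw [ha] at n1
  have key := reflection_of_fix h c c' hσ hu
  have hav := ((hσ a v).1 (c.cover_right h).1).1
  have eq_u (x : V) (hx : pos x = pos a + 1) : x = u := h.inj (by omega)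
  have move (hau : a' ≠ u) := ((hσ a' u').1 ⟨c'.lt_left, fun e => hau e.1⟩).1
  rw [ha] at hav
  rcases key with key | key
  · have k1 := key a (c.ne_au h)
    have k2 := key v (c.ne_uv h).symm
    rw [ha] at k1
    rcases c'.pos_eq with p' | p'
    · unfold skip at k1 k2
      split_ifs at k1 k2 <;> omega
    · have e1 : a' = u := h.inj (by unfold skip at k1; split_ifs at k1 <;> omega)
      have e2 : u' = a := h.inj (by rw [e1] at p'; omega)
      exact (hua (e1 ▸ e2 ▸ c'.lt_left)).elim
  · have k1 := key a (c.ne_au h)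
    have k2 := key v (c.ne_uv h).symm
    rw [ha] at k1
    rcases c'.pos_eq with p' | p'
    · have s : pos a' = m - 1 - pos a := by unfold skip at k1; split_ifs at k1 <;> omega
      -- If the triples coincide, the identity serves. Otherwise the reflection turns `a' < u'` or
      -- `a < v` into `u < a`, or puts an element above the maximal `v'`.
      rcases lt_trichotomy (pos a') (pos a) with hlt | heq | hgt
      · have e1 : a' ≠ u := fun e => by rw [e] at hlt; omega
        have k3 := key a' e1
        have n3 := hne e1
        have mv := move e1
        by_cases e2 : u' = a
        · have : σ a' = v' := h.inj (by
            rw [e2] at k3 n3 p'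
            unfold skip at k3; split_ifs at k3 <;> omega)
          rw [this] at mv
          exact (c'.max _ mv).elim
        · have e3 : u' ≠ u := fun e => by rw [e] at p'; omega
          have e4 : pos u' ≠ pos a := fun e => e2 (h.inj e)
          have k4 := key u' e3
          have n4 := hne e3
          have f1 : σ a' = u := h.inj (by
            unfold skip at k3; split_ifs at k3 <;> omega)
          have f2 : σ u' = a := h.inj (by
            unfold skip at k4; split_ifs at k4 <;> omega)
          rw [f1, f2] at mv
          exact (hua mv).elim
      · have e1 : u' = u := h.inj (by omega)
        have e2 : v' = v := h.inj (by omega)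
        exact ⟨Equiv.refl V, fun _ _ => Iff.rfl, e1.symm, e2.symm⟩
      · by_cases e1 : a' = u
        · have : σ v = a := h.inj (by
            rw [e1] at p' s
            unfold skip at k2; split_ifs at k2 <;> omega)
          rw [this, e1] at hav
          exact (hua hav).elim
        · have e2 : pos a' ≠ pos u := fun e => e1 (h.inj e)
          have e3 : u' ≠ u := fun e => by rw [e] at p'; omega
          have k3 := key a' e1
          have n3 := hne e1
          have mv := move e1
          have k4 := key u' e3
          have n4 := hne e3
          have f1 : σ a' = u := h.inj (by
            unfold skip at k3; split_ifs at k3 <;> omega)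
          have f2 : σ u' = a := h.inj (by
            unfold skip at k4; split_ifs at k4 <;> omega)
          rw [f1, f2] at mv
          exact (hua mv).elim
    · unfold skip at k1 k2
      split_ifs at k1 k2 <;> omega

theorem exists_aut_of_fix (h : IsPathOrder lt pos m) (c : IsSinkCut lt pos a u v)
    (c' : IsSinkCut lt pos a' u' v') {σ : V ≃ V}
    (hσ : ∀ x y, cutRel lt u v x y ↔ cutRel lt u' v' (σ x) (σ y)) (hu : σ u = u') :
    ∃ τ : V ≃ V, (∀ x y, lt x y ↔ lt (τ x) (τ y)) ∧ τ u = u' ∧ τ v = v' := by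
  rcases c.pos_eq with p | p
  · exact exists_aut_of_fix_right h c c' hσ hu p
  · exact exists_aut_of_fix_right h.rev (c.rev (m := m)) c'.rev hσ hu (by omega)

/-- In the second cut order `σ u` and `u'` are both maximal with `a'` as unique lower cover, so
exchanging them is an automorphism. This reduces to `σ u = u'`. -/
theorem exists_aut_of_base (h : IsPathOrder lt pos m) (c : IsSinkCut lt pos a u v)
    (c' : IsSinkCut lt pos a' u' v') {σ : V ≃ V}
    (hσ : ∀ x y, cutRel lt u v x y ↔ cutRel lt u' v' (σ x) (σ y)) (ha : σ a = a') :
    ∃ τ : V ≃ V, (∀ x y, lt x y ↔ lt (τ x) (τ y)) ∧ τ u = u' ∧ τ v = v' := by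
  classical
  have l1 := (c.lowerCover h).map hσ
  have l2 := c'.lowerCover h
  rw [ha] at l1
  have m1 (y : V) : ¬ cutRel lt u' v' (σ u) y := fun e => c.cut_max h (σ.symm y) (by
    rwa [hσ, Equiv.apply_symm_apply])
  have m2 := c'.cut_max h
  refine exists_aut_of_fix h c c' (σ := σ.trans (Equiv.swap (σ u) u')) (fun x y => ?_) (by simp)
  rw [hσ]
  simp only [Equiv.trans_apply, Equiv.swap_apply_def]
  have d (x : V) : cutRel lt u' v' x (σ u) ↔ cutRel lt u' v' x u' := by rw [l1, l2]
  split_ifs with h1 h2 h3 h4 h5 h6 h7 <;> simp_all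

/-- The only cover of a cut order that is not between neighbours on the line starts at its base. As
`σ a ≠ a'`, the covers starting at `σ a` therefore lead to honest neighbours, of which there are at
most two. -/
theorem endpoints_of_ne (h : IsPathOrder lt pos m) (c : IsSinkCut lt pos a u v)
    (c' : IsSinkCut lt pos a' u' v') {σ : V ≃ V}
    (hσ : ∀ x y, cutRel lt u v x y ↔ cutRel lt u' v' (σ x) (σ y)) (ha : σ a ≠ a') :
    (pos a = 0 ∨ pos a = m) ∧ (pos (σ u) = 0 ∨ pos (σ u) = m) := by
  have low := (c.lowerCover h).map hσ
  have ca := (c.cover_left h).map hσ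
  have cv := (c.cover_right h).map hσ
  have m1 (y : V) : ¬ cutRel lt u' v' (σ u) y := fun e => c.cut_max h (σ.symm y) (by
    rwa [hσ, Equiv.apply_symm_apply])
  have bz := h.nonneg (σ u)
  have bz' := h.le (σ u)
  have zu : σ u ≠ u' := by
    intro e
    rw [e] at low
    exact ha (h.lowerCover_unique low (c'.lowerCover h))
  have zmax (y : V) : ¬ lt (σ u) y := fun e => m1 y ⟨e, fun k => zu k.1⟩
  have yu : σ a ≠ u' := fun e => c'.cut_max h _ (e ▸ ca.1)
  have uz : u ≠ v := c.ne_uv h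
  have adjc {x y : V} (hc : IsCover (cutRel lt u' v') x y) (hx : x ≠ a') :
      pos y = pos x + 1 ∨ pos y = pos x - 1 :=
    (c'.cover_adj h hc).resolve_right fun e => hx e.1
  have pz := adjc ca ha
  have pv := adjc cv ha
  have zv : σ u ≠ v' := by
    intro e
    have := (low a').1 (e ▸ (c'.cover_right h).1)
    rcases this with k | k
    · exact ha k.symm
    · exact (c'.cover_right h).2 _ ⟨k, e ▸ ca.1⟩
  have hz : pos (σ u) = 0 ∨ pos (σ u) = m := by
    by_contra hcon
    push Not at hcon
    -- The neighbour of `σ u` opposite to `σ a`. It would lie below the maximal `σ u`, hence below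
    -- `σ a`, its unique lower cover.
    obtain ⟨x, hx⟩ : ∃ x, pos x = 2 * pos (σ u) - pos (σ a) := h.surj _ (by omega) (by omega)
    have l : lt x (σ u) := (show pos (σ u) = pos x + 1 ∨ pos x = pos (σ u) + 1 by omega).elim
      (fun e => (h.adj e).resolve_right (zmax _)) (fun e => (h.adj e).resolve_left (zmax _))
    rcases (low x).1 ⟨l, fun k => zv k.2⟩ with e | e
    · rw [e] at hx; omega
    · have := h.between e.1 ca.1.1
      omega
  refine ⟨?_, hz⟩
  by_contra hcon
  push Not at hcon
  have b1 := h.nonneg a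
  have b2 := h.le a
  have b3 := h.nonneg (σ v)
  have b4 := h.le (σ v)
  -- The neighbour of `a` opposite to `u`. The images of `x`, `u` and `v` would be three distinct
  -- neighbours of `σ a`.
  obtain ⟨x, hx⟩ : ∃ x, pos x = 2 * pos a - pos u := h.surj _ (by have := c.pos_eq; omega)
    (by have := c.pos_eq; omega)
  have hxu : x ≠ u := fun e => by have := c.pos_eq; rw [e] at hx; omega
  have hxv : x ≠ v := fun e => by have := c.pos_eq; rw [e] at hx; omega
  have hpx : pos a = pos x + 1 ∨ pos x = pos a + 1 := by have := c.pos_eq; omega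
  have hcx : IsCover (cutRel lt u v) a x ∨ IsCover (cutRel lt u v) x a := by
    have : lt a x ∨ lt x a := hpx.elim (fun e => (h.adj e).symm) (fun e => h.adj e)
    refine this.imp (fun l => ⟨⟨l, fun k => hxv k.2⟩, fun z hz => ?_⟩)
      (fun l => ⟨⟨l, fun k => hxu k.1⟩, fun z hz => ?_⟩)
    all_goals exact h.not_mid hz.1.1 hz.2.1 (by omega)
  have px : pos (σ a) = pos (σ x) + 1 ∨ pos (σ a) = pos (σ x) - 1 := by
    rcases hcx with e | e
    · have := adjc (e.map hσ) ha
      omega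
    · have e' := e.map hσ
      rcases c'.cover_adj h e' with k | k
      · exact k
      · exact (c'.max _ (k.2 ▸ ca.1.1)).elim
  have d1 : pos (σ x) ≠ pos (σ u) := fun e => hxu (σ.injective (h.inj e))
  have d2 : pos (σ x) ≠ pos (σ v) := fun e => hxv (σ.injective (h.inj e))
  have d3 : pos (σ v) ≠ pos (σ u) := fun e => uz (σ.injective (h.inj e)).symm
  omega

/-- If `σ a ≠ a'`, then `a`, `a'` and `σ u` are endpoints of the line. Either `a = a'`, and the
endpoint determines the triple, or `σ u`, maximal in the second cut order, equals `a` or `a'`,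
neither of which is maximal there. -/
theorem exists_aut (h : IsPathOrder lt pos m) (c : IsSinkCut lt pos a u v)
    (c' : IsSinkCut lt pos a' u' v') {σ : V ≃ V}
    (hσ : ∀ x y, cutRel lt u v x y ↔ cutRel lt u' v' (σ x) (σ y)) :
    ∃ τ : V ≃ V, (∀ x y, lt x y ↔ lt (τ x) (τ y)) ∧ τ u = u' ∧ τ v = v' := by
  by_cases ha : σ a = a'
  · exact exists_aut_of_base h c c' hσ ha
  obtain ⟨e1, e2⟩ := endpoints_of_ne h c c' hσ ha
  obtain ⟨e3, -⟩ := endpoints_of_ne h c' c (σ := σ.symm) (map_symm_iff hσ)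
    (fun e => ha (by rw [← e, Equiv.apply_symm_apply]))
  have b1 := h.nonneg u
  have b2 := h.le u
  have b3 := h.nonneg u'
  have b4 := h.le u'
  have p := c.pos_eq
  have p' := c'.pos_eq
  by_cases haa : a = a'
  · subst haa
    have b5 := h.nonneg v
    have b6 := h.le v
    have b7 := h.nonneg v'
    have b8 := h.le v'
    exact ⟨Equiv.refl V, fun _ _ => Iff.rfl, h.inj (by simp only [Equiv.refl_apply]; omega),
      h.inj (by simp only [Equiv.refl_apply]; omega)⟩
  · exfalso
    have m1 (y : V) : ¬ cutRel lt u' v' (σ u) y := fun e => c.cut_max h (σ.symm y) (by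
      rwa [hσ, Equiv.apply_symm_apply])
    have q : pos a ≠ pos a' := fun e => haa (h.inj e)
    have : pos (σ u) = pos a ∨ pos (σ u) = pos a' := by omega
    rcases this with e | e
    · rw [h.inj e] at m1
      exact m1 u ⟨c.lt_left, fun k => c'.max v (k.2 ▸ c.lt_right)⟩
    · rw [h.inj e] at m1
      exact m1 _ (c'.cover_left h).1

end IsSinkCut

/-! ### Isomorphic connected cuts are conjugate. -/

namespace IsPathOrder

variable {V : Type*} {lt : V → V → Prop} {pos : V → ℤ} {m : ℤ}

theorem isSinkCut (h : IsPathOrder lt pos m) {a u v : V} (hau : lt a u) (huv : lt u v)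
    (hcov : ∀ z, ¬ (lt u z ∧ lt z v)) (hmax : ∀ y, ¬ lt v y) : ∃ a, IsSinkCut lt pos a u v := by
  have p := h.adj_of_cover huv hcov
  have q := h.between hau huv
  have b1 := h.nonneg a
  have b2 := h.le a
  have b3 := h.nonneg v
  have b4 := h.le v
  obtain ⟨x, hx⟩ : ∃ x, pos x = 2 * pos u - pos v := h.surj _ (by omega) (by omega)
  refine ⟨x, ?_, huv, by omega, hmax⟩
  by_cases e : x = a
  · rwa [e]
  · have : pos x ≠ pos a := fun k => e (h.inj k)
    exact (h.conv hau (by omega)).2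

/-- Cutting an arrow whose source is minimal, but whose target is not maximal, leaves the set of
maximal elements unchanged. -/
theorem max_cut_iff_of_min (h : IsPathOrder lt pos m) {u v b : V} (huv : lt u v)
    (hvb : lt v b) (x : V) : (∀ y, ¬ cutRel lt u v x y) ↔ ∀ y, ¬ lt x y := by
  refine ⟨fun k y hy => ?_, fun k y hy => k y hy.1⟩
  by_cases e : x = u
  · subst e
    exact k b ⟨h.trans huv hvb, fun e => h.irrefl v (e.2 ▸ hvb)⟩
  · exact k y ⟨hy, fun k => e k.1⟩

/-- The two cut orders differ in their number of maximal elements: a sink cut makes `u` newly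
maximal, while a cut with an element above `v'` creates none. -/
theorem not_sink_source [Fintype V] (h : IsPathOrder lt pos m) {a u v u' v' b : V}
    (c : IsSinkCut lt pos a u v) (huv' : lt u' v') (hvb : lt v' b) (σ : V ≃ V)
    (hσ : ∀ x y, cutRel lt u v x y ↔ cutRel lt u' v' (σ x) (σ y)) : False := by
  have e1 : {x | ∀ y, ¬ cutRel lt u v x y} = insert u {x | ∀ y, ¬ lt x y} := by
    ext x
    simp only [Set.mem_ofPred_eq, Set.mem_insert_iff]
    constructor
    · intro k
      by_cases e : x = u
      · exact Or.inl e
      · exact Or.inr fun y hy => k y ⟨hy, fun k => e k.1⟩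
    · rintro (rfl | k) y hy
      · exact c.cut_max h y hy
      · exact k y hy.1
  have e2 : {x | ∀ y, ¬ cutRel lt u' v' x y} = {x | ∀ y, ¬ lt x y} :=
    Set.ext fun x => h.max_cut_iff_of_min huv' hvb x
  have e3 : σ '' {x | ∀ y, ¬ cutRel lt u v x y} = {x | ∀ y, ¬ cutRel lt u' v' x y} := by
    ext x
    rw [Equiv.image_eq_preimage_symm]
    simp only [Set.mem_preimage, Set.mem_ofPred_eq]
    refine σ.forall_congr fun y => ?_
    rw [hσ, Equiv.apply_symm_apply]
  have e4 := Set.ncard_image_of_injective {x | ∀ y, ¬ cutRel lt u v x y} σ.injective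
  rw [e3, e2, e1, Set.ncard_insert_of_notMem (fun k => (Set.mem_ofPred_eq ▸ k :) v c.lt_right)] at e4
  omega

/-- Isomorphic connected cuts of a path order are conjugate under its automorphism group. -/
theorem exists_aut_of_cut_iso [Fintype V] (h : IsPathOrder lt pos m) {u v u' v' : V}
    (huv : lt u v) (hcov : ∀ z, ¬ (lt u z ∧ lt z v)) (hc : (∃ a, lt a u) ∨ ∃ b, lt v b)
    (huv' : lt u' v') (hcov' : ∀ z, ¬ (lt u' z ∧ lt z v')) (hc' : (∃ a, lt a u') ∨ ∃ b, lt v' b)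
    (σ : V ≃ V) (hσ : ∀ x y, cutRel lt u v x y ↔ cutRel lt u' v' (σ x) (σ y)) :
    ∃ τ : V ≃ V, (∀ x y, lt x y ↔ lt (τ x) (τ y)) ∧ τ u = u' ∧ τ v = v' := by
  have hσ' := map_symm_iff hσ
  by_cases h1 : ∃ a, lt a u
  · obtain ⟨a, ha⟩ := h1
    by_cases h2 : ∃ b, lt v b
    · obtain ⟨b, hb⟩ := h2
      exact h.exists_aut_of_interior huv hcov huv' ha hb σ hσ
    push Not at h2
    obtain ⟨a, c⟩ := h.isSinkCut ha huv hcov h2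
    by_cases h3 : ∃ b, lt v' b
    · obtain ⟨b, hb⟩ := h3
      exact (h.not_sink_source c huv' hb σ hσ).elim
    · obtain ⟨a', ha'⟩ := hc'.resolve_right h3
      push Not at h3
      obtain ⟨a', c'⟩ := h.isSinkCut ha' huv' hcov' h3
      exact c.exists_aut h c' hσ
  · obtain ⟨b, hb⟩ := hc.resolve_left h1
    push Not at h1
    -- Here `u` is minimal; in the reversed order the deleted pair is `(v, u)`, with maximal upper
    -- end `u`.
    have hd (x y : V) : cutRel (fun x y => lt y x) v u x y ↔
        cutRel (fun x y => lt y x) v' u' (σ x) (σ y) := by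
      have := hσ y x
      simp only [cutRel] at this ⊢
      rw [and_comm (a := x = v), and_comm (a := σ x = v')]
      exact this
    obtain ⟨b, c⟩ := h.dual.isSinkCut hb huv (fun z hz => hcov z hz.symm) h1
    by_cases h3 : ∃ a, lt a u'
    · obtain ⟨a, ha⟩ := h3
      exact (h.dual.not_sink_source c huv' ha σ hd).elim
    · obtain ⟨b', hb'⟩ := hc'.resolve_left h3
      push Not at h3
      obtain ⟨b', c'⟩ := h.dual.isSinkCut hb' huv' (fun z hz => hcov' z hz.symm) h3
      obtain ⟨τ, t1, t2, t3⟩ := c.exists_aut h.dual c' hd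
      exact ⟨τ, fun x y => t1 y x, t3, t2⟩

end IsPathOrder

/-! ### Incidence representations -/

/-- A faithful matrix representation whose image consists of all matrices supported on the
relation `r`. -/
structure IsIncidenceRep {k V B : Type*} [Field k] [Fintype V] [DecidableEq V] [Ring B]
    [Algebra k B] (r : V → V → Prop) (Φ : B →ₐ[k] Matrix V V k) : Prop where
  inj : Function.Injective Φ
  supp : ∀ x a b, Φ x a b ≠ 0 → r a b
  exists_single : ∀ a b, r a b → ∃ x, Φ x = Matrix.single a b 1

/-! ### Connectedness through central idempotents. -/

/-- Every central idempotent is trivial. -/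
def HasTrivialCentralIdempotents (A : Type*) [Ring A] : Prop :=
  ∀ ε : A, IsIdempotentElem ε → (∀ x, ε * x = x * ε) → ε = 0 ∨ ε = 1

theorem HasTrivialCentralIdempotents.of_equiv {A A' F : Type*} [Ring A] [Ring A'] [EquivLike F A A']
    [RingEquivClass F A A'] (φ : F) (h : HasTrivialCentralIdempotents A) :
    HasTrivialCentralIdempotents A' := by
  let ψ : A' ≃+* A := (RingEquivClass.toRingEquiv φ).symm
  intro ε hε hc
  refine (h (ψ ε) ?_ fun x => ?_).imp (fun e => ?_) (fun e => ?_)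
  · rw [IsIdempotentElem, ← map_mul, hε.eq]
  · obtain ⟨y, rfl⟩ := ψ.surjective x
    rw [← map_mul, ← map_mul, hc]
  · exact ψ.injective (by rw [e, map_zero])
  · exact ψ.injective (by rw [e, map_one])

/-- An algebra with a connected Ext quiver is connected. -/
theorem HasConnectedExtQuiver.hasTrivialCentralIdempotents {k A : Type*} [Field k] [Ring A]
    [Algebra k A] (h : HasConnectedExtQuiver k A) : HasTrivialCentralIdempotents A := by
  obtain ⟨n, e, he, hprim, hconn⟩ := h
  intro ε hε hc
  -- The primitive `e i` splits as `e i * ε + e i * (1 - ε)`.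
  have alt (i : Fin n) : e i * ε = 0 ∨ e i * ε = e i := by
    have hi := (hprim i).1
    have h1 : IsIdempotentElem (e i * ε) := hi.mul_of_commute (hc (e i)).symm hε
    have h2 : IsIdempotentElem (e i * (1 - ε)) :=
      hi.mul_of_commute (by simp [Commute, SemiconjBy, mul_sub, sub_mul, hc]) hε.one_sub
    have h3 : e i * ε * (e i * (1 - ε)) = 0 := by
      rw [mul_assoc, ← mul_assoc ε, hc, mul_assoc (e i) ε, mul_sub, mul_one, hε.eq, sub_self,
        mul_zero, mul_zero]
    have h4 : e i * (1 - ε) * (e i * ε) = 0 := by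
      rw [← hc (e i), mul_assoc, ← mul_assoc (1 - ε), sub_mul, one_mul, hε.eq, sub_self,
        zero_mul, mul_zero]
    rcases (hprim i).2.2 _ _ h1 h2 h3 h4 (by rw [← mul_add]; simp) with k | k
    · exact Or.inl k
    · right
      rw [mul_sub, mul_one, sub_eq_zero] at k
      exact k.symm
  -- For two idempotents on opposite sides of `ε`, moving `ε` past `x` kills every `e i * x * e j`.
  -- So membership in one side propagates along the edges of the Ext quiver.
  have noarrow {i j : Fin n} (h0 : (e i * ε = 0 ∧ e j * ε = e j) ∨ (e i * ε = e i ∧ e j * ε = 0)) :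
      radicalLayer k (e i) (e j) = ⊥ := by
    have hz (x : A) : e i * (x * e j) = 0 := by
      rcases h0 with ⟨h1, h2⟩ | ⟨h1, h2⟩
      · rw [← h2, ← hc, ← mul_assoc x, ← hc x, mul_assoc, ← mul_assoc (e i), h1, zero_mul]
      · rw [← h1, mul_assoc, ← mul_assoc ε, hc x, mul_assoc x, hc, h2, mul_zero, mul_zero]
    rw [eq_bot_iff]
    rintro _ ⟨x, _, rfl⟩
    simp [hz]
  have const (i j : Fin n) (hi : e i * ε = e i) : e j * ε = e j := by
    have reach := (SimpleGraph.reachable_iff_reflTransGen _ _).1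
      (hconn.preconnected (i : ExtQuiver k e) j)
    induction reach with
    | refl => exact hi
    | @tail b c _ hbc ih =>
      refine (alt c).resolve_left fun hc0 => ?_
      have hbc := ((SimpleGraph.fromRel_adj _ _ _).1 hbc).2
      have empty (x y : ExtQuiver k e) (hxy : radicalLayer k (e x) (e y) = ⊥)
          (ha : Nonempty (x ⟶ y)) : False := by
        obtain ⟨a⟩ := ha
        have a' : Fin (Module.finrank k (radicalLayer k (e x) (e y))) := a
        rw [hxy, finrank_bot] at a'
        exact a'.elim0
      rcases hbc with ha | ha
      · exact empty b c (noarrow (Or.inr ⟨ih, hc0⟩)) ha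
      · exact empty c b (noarrow (Or.inl ⟨hc0, ih⟩)) ha
  have sum : ε = ∑ i, e i * ε := by rw [← Finset.sum_mul, he.complete, one_mul]
  by_cases hall : ∀ i, e i * ε = 0
  · left
    rw [sum, Finset.sum_eq_zero fun i _ => hall i]
  · right
    push Not at hall
    obtain ⟨i, hi⟩ := hall
    rw [sum, ← he.complete]
    exact Finset.sum_congr rfl fun j _ => const i j ((alt i).resolve_left hi)

/-! ### Idempotents and isomorphisms of incidence algebras. -/

namespace IsIncidenceRep

variable {k V B : Type*} [Field k] [Fintype V] [DecidableEq V] [Ring B] [Algebra k B]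
  {r : V → V → Prop} {Φ : B →ₐ[k] Matrix V V k}

theorem mem_range_iff (h : IsIncidenceRep r Φ) (M : Matrix V V k) :
    M ∈ Φ.range ↔ ∀ a b, M a b ≠ 0 → r a b := by
  constructor
  · rintro ⟨x, rfl⟩
    exact h.supp x
  · intro hM
    rw [Matrix.matrix_eq_sum_single M]
    refine Subalgebra.sum_mem _ fun a _ => Subalgebra.sum_mem _ fun b _ => ?_
    by_cases hab : M a b = 0
    · simp [hab]
    · obtain ⟨x, hx⟩ := h.exists_single a b (hM a b hab)
      have : Matrix.single a b (M a b) = M a b • (Matrix.single a b 1 : Matrix V V k) := by simp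
      rw [this, ← hx]
      exact Subalgebra.smul_mem _ (AlgHom.mem_range_self Φ x) _

theorem diag_mul (h : IsIncidenceRep r Φ) [IsPartialOrder V r] (x y : B) (v : V) :
    Φ (x * y) v v = Φ x v v * Φ y v v := by
  rw [map_mul, Matrix.mul_apply]
  refine Finset.sum_eq_single v (fun w _ hw => ?_) (by simp)
  by_contra hne
  exact hw (antisymm (h.supp y w v (right_ne_zero_of_mul hne))
    (h.supp x v w (left_ne_zero_of_mul hne)))

/-- Such a matrix is strictly triangular for the height `ht`, the number of elements below: each
factor raises the height, which is at most `|V|`. -/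
theorem isNilpotent (h : IsIncidenceRep r Φ) [IsPartialOrder V r] {x : B}
    (hx : ∀ v, Φ x v v = 0) : IsNilpotent x := by
  classical
  let ht (a : V) : ℕ := (Finset.univ.filter fun c => r c a).card
  have hlt {a b : V} (hab : r a b) (hne : a ≠ b) : ht a < ht b := by
    refine Finset.card_lt_card (Finset.ssubset_iff_subset_ne.2 ⟨fun c hc => ?_, fun e => ?_⟩)
    · simp only [Finset.mem_filter, Finset.mem_univ, true_and] at hc ⊢
      exact _root_.trans hc hab
    · have : b ∈ Finset.univ.filter fun c => r c a := by
        rw [e]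
        simpa using refl (r := r) b
      simp only [Finset.mem_filter, Finset.mem_univ, true_and] at this
      exact hne (antisymm hab this)
  have key (j : ℕ) (a b : V) (hab : (Φ x ^ j) a b ≠ 0) : ht a + j ≤ ht b := by
    induction j generalizing b with
    | zero =>
      by_cases e : a = b
      · simp [e]
      · simp [Matrix.one_apply_ne e] at hab
    | succ j ih =>
      rw [pow_succ, Matrix.mul_apply] at hab
      obtain ⟨c, _, hc⟩ := Finset.exists_ne_zero_of_sum_ne_zero hab
      have h1 := ih c (left_ne_zero_of_mul hc)
      have h2 := right_ne_zero_of_mul hc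
      have h3 := hlt (h.supp x c b h2) (fun e => h2 (e ▸ hx c))
      omega
  refine ⟨Fintype.card V + 1, h.inj ?_⟩
  rw [map_pow, map_zero]
  ext a b
  by_contra hne
  have h1 := key _ a b hne
  have h2 : ht b ≤ Fintype.card V := Finset.card_le_univ _
  omega

theorem completeOrthogonalIdempotents (h : IsIncidenceRep r Φ) {E : V → B}
    (hE : ∀ v, Φ (E v) = Matrix.single v v 1) : CompleteOrthogonalIdempotents E where
  idem v := h.inj (by simp [hE])
  ortho v w hvw := h.inj (by simp [hE, Matrix.single_mul_single_of_ne _ _ _ _ hvw])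
  complete := h.inj (by simp only [map_sum, hE, map_one, Matrix.sum_single_one])

theorem idempotent_ne_zero {E : V → B}
    (hE : ∀ v, Φ (E v) = Matrix.single v v 1) (v : V) : E v ≠ 0 := by
  intro e
  have := congrFun (congrFun (hE v) v) v
  simp [e] at this

theorem map_mul_mul {E : V → B}
    (hE : ∀ v, Φ (E v) = Matrix.single v v 1) (x : B) (a b : V) :
    Φ (E a * x * E b) = Matrix.single a b (Φ x a b) := by
  simp [hE, Matrix.single_mul_mul_single]

/-- Recovers the relation from the idempotents alone, so that algebra isomorphisms and conjugations
can transport it. -/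
theorem rel_iff (h : IsIncidenceRep r Φ) {E : V → B}
    (hE : ∀ v, Φ (E v) = Matrix.single v v 1) (a b : V) : r a b ↔ ∃ x, E a * x * E b ≠ 0 := by
  constructor
  · intro hab
    obtain ⟨x, hx⟩ := h.exists_single a b hab
    refine ⟨x, fun e => ?_⟩
    have := map_mul_mul hE x a b
    rw [e, hx] at this
    simpa using congrFun (congrFun this a) b
  · rintro ⟨x, hx⟩
    refine h.supp x a b fun e => hx (h.inj ?_)
    rw [map_mul_mul hE, e]
    simp

/-- A complete family of `|V|` nonzero orthogonal idempotents is conjugate to the standard one. -/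
theorem exists_conj (h : IsIncidenceRep r Φ) [IsPartialOrder V r] {E : V → B}
    (hE : ∀ v, Φ (E v) = Matrix.single v v 1) {ι : Type*} [Fintype ι] {f : ι → B}
    (hf : CompleteOrthogonalIdempotents f) (hf0 : ∀ i, f i ≠ 0)
    (hcard : Fintype.card V = Fintype.card ι) :
    ∃ (c : Bˣ) (s : ι ≃ V), ∀ i, c * f i = E (s i) * c := by
  have hEc := h.completeOrthogonalIdempotents hE
  have ex (v : V) : ∃ i, Φ (f i) v v ≠ 0 := by
    by_contra hcon
    push Not at hcon
    have := congrArg (fun x => Φ x v v) hf.complete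
    simp [Matrix.sum_apply, hcon] at this
  choose t ht using ex
  have idem (i : ι) (v : V) : Φ (f i) v v * Φ (f i) v v = Φ (f i) v v := by
    rw [← h.diag_mul, (hf.idem i).eq]
  -- A member of the family missed by `t` would have zero diagonal, hence be a nilpotent idempotent.
  have surj : Function.Surjective t := by
    intro i
    by_contra hcon
    push Not at hcon
    have hz (v : V) : Φ (f i) v v = 0 := by
      have := h.diag_mul (f (t v)) (f i) v
      rw [hf.ortho (hcon v), map_zero, Matrix.zero_apply] at this
      exact (mul_eq_zero.1 this.symm).resolve_left (ht v)
    obtain ⟨N, hN⟩ := h.isNilpotent hz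
    apply hf0 i
    rw [← (hf.idem i).pow_succ_eq N, pow_succ, hN, zero_mul]
  let s := Equiv.ofBijective t ((Fintype.bijective_iff_surjective_and_card t).2 ⟨surj, hcard⟩)
  -- This intertwines the two families; its diagonal is `1`, so it is unipotent.
  let c : B := ∑ v, E v * f (t v)
  have hc : IsUnit c := by
    have hn : IsNilpotent (c - 1) := by
      refine h.isNilpotent fun w => ?_
      have h1 : Φ (f (t w)) w w = 1 := mul_right_cancel₀ (ht w) (by rw [idem, one_mul])
      have h2 : Φ c w w = 1 := by
        simp only [c, map_sum, Matrix.sum_apply, h.diag_mul, hE]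
        rw [Finset.sum_eq_single w (fun v _ hv => by simp [hv]) (by simp)]
        simp [h1]
      simp [h2]
    simpa using hn.isUnit_one_add
  refine ⟨hc.unit, s.symm, fun i => ?_⟩
  obtain ⟨w, rfl⟩ := s.surjective i
  rw [Equiv.symm_apply_apply, IsUnit.unit_spec]
  have h1 : c * f (s w) = E w * f (s w) := by
    simp only [c, Finset.sum_mul]
    rw [Finset.sum_eq_single w (fun v _ hv => ?_) (by simp)]
    · change E w * f (s w) * f (s w) = _
      rw [mul_assoc, (hf.idem _).eq]
    · change E v * f (s v) * f (s w) = 0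
      rw [mul_assoc, hf.ortho (s.injective.ne hv), mul_zero]
  have h2 : E w * c = E w * f (s w) := by
    simp only [c, Finset.mul_sum]
    rw [Finset.sum_eq_single w (fun v _ hv => ?_) (by simp)]
    · rw [← mul_assoc, (hEc.idem w).eq]
      rfl
    · rw [← mul_assoc, hEc.ortho hv.symm, zero_mul]
  rw [h1, h2]

/-- Isomorphic incidence algebras come from isomorphic relations. -/
theorem exists_equiv {B' : Type*} [Ring B'] [Algebra k B'] {r' : V → V → Prop}
    {Φ' : B' →ₐ[k] Matrix V V k} (h : IsIncidenceRep r Φ) (h' : IsIncidenceRep r' Φ')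
    [Std.Refl r] [IsPartialOrder V r'] (φ : B ≃ₐ[k] B') :
    ∃ σ : V ≃ V, ∀ x y, r x y ↔ r' (σ x) (σ y) := by
  choose E hE using fun v => h.exists_single v v (refl v)
  choose E' hE' using fun v => h'.exists_single v v (refl v)
  have hf : CompleteOrthogonalIdempotents (fun v => φ (E v)) :=
    (h.completeOrthogonalIdempotents hE).map (φ : B →+* B')
  obtain ⟨c, s, hs⟩ := h'.exists_conj hE' hf
    (fun v => (map_ne_zero_iff φ φ.injective).2 (idempotent_ne_zero hE v)) rfl
  have hs' (v : V) : φ (E v) = ↑c⁻¹ * E' (s v) * c := by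
    rw [mul_assoc, ← hs, Units.inv_mul_cancel_left]
  refine ⟨s, fun x y => ?_⟩
  rw [h.rel_iff hE, h'.rel_iff hE']
  constructor
  · rintro ⟨b, hb⟩
    refine ⟨c * φ b * ↑c⁻¹, fun e => hb (φ.injective ?_)⟩
    have : φ (E x * b * E y) = ↑c⁻¹ * (E' (s x) * (c * φ b * ↑c⁻¹) * E' (s y)) * c := by
      rw [map_mul, map_mul, hs', hs']
      simp only [mul_assoc]
    rw [this, e]
    simp
  · rintro ⟨b, hb⟩
    obtain ⟨d, hd⟩ := φ.surjective (↑c⁻¹ * b * c)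
    refine ⟨d, fun e => hb ?_⟩
    have : φ (E x * d * E y) = ↑c⁻¹ * (E' (s x) * b * E' (s y)) * c := by
      rw [map_mul, map_mul, hs', hs', hd]
      simp only [mul_assoc, Units.mul_inv_cancel_left]
    rw [e, map_zero] at this
    have := congrArg (fun z : B' => (c : B') * z * ↑c⁻¹) this
    simpa [mul_assoc] using this.symm

/-- Automorphisms of the relation act on the incidence algebra. -/
theorem exists_algEquiv (h : IsIncidenceRep r Φ) (τ : V ≃ V)
    (hτ : ∀ x y, r x y ↔ r (τ x) (τ y)) :
    ∃ φ : B ≃ₐ[k] B, ∀ x a b, Φ (φ x) (τ a) (τ b) = Φ x a b := by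
  let Φ' : B →ₐ[k] Matrix V V k := (Matrix.reindexAlgEquiv k k τ : _ →ₐ[k] _).comp Φ
  have inj' : Function.Injective Φ' := (Matrix.reindexAlgEquiv k k τ).injective.comp h.inj
  have happ (x : B) (a b : V) : Φ' x a b = Φ x (τ.symm a) (τ.symm b) := rfl
  -- Relabelling the indices by `τ` preserves the image of `Φ`, so `Φ'` followed by the inverse of
  -- `Φ` is an automorphism of `B`.
  have hrange : Φ'.range = Φ.range := by
    ext M
    rw [h.mem_range_iff]
    constructor
    · rintro ⟨x, rfl⟩ a b hab
      have := h.supp x _ _ hab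
      rwa [hτ, Equiv.apply_symm_apply, Equiv.apply_symm_apply] at this
    · intro hM
      obtain ⟨x, hx⟩ := (h.mem_range_iff (fun a b => M (τ a) (τ b))).2 fun a b hab =>
        (hτ a b).2 (hM _ _ hab)
      refine ⟨x, ?_⟩
      ext a b
      change Φ' x a b = _
      rw [happ]
      have := congrFun (congrFun hx (τ.symm a)) (τ.symm b)
      simpa using this
  refine ⟨(AlgEquiv.ofInjective Φ' inj').trans ((Subalgebra.equivOfEq _ _ hrange).trans
    (AlgEquiv.ofInjective Φ h.inj).symm), fun x a b => ?_⟩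
  have hx (y : Φ.range) : Φ ((AlgEquiv.ofInjective Φ h.inj).symm y) = y :=
    congrArg Subtype.val ((AlgEquiv.ofInjective Φ h.inj).apply_symm_apply y)
  rw [AlgEquiv.trans_apply, AlgEquiv.trans_apply, hx]
  change Φ' x _ _ = _
  simp [happ]

end IsIncidenceRep

theorem IsPathOrder.isPartialOrder {V : Type*} {lt : V → V → Prop} {pos : V → ℤ} {m : ℤ}
    (h : IsPathOrder lt pos m) : IsPartialOrder V fun x y => x = y ∨ lt x y where
  refl _ := Or.inl rfl
  trans x y z := by
    rintro (rfl | h1) (rfl | h2)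
    exacts [Or.inl rfl, Or.inr h2, Or.inr h1, Or.inr (h.trans h1 h2)]
  antisymm x y := by
    rintro (rfl | h1) (h2 | h2)
    exacts [rfl, rfl, h2.symm, (h.asymm h1 h2).elim]

/-- A subrelation isomorphic to `r` without one pair is `r` without one pair. -/
theorem exists_missing_pair {V : Type*} [Fintype V] {r r' : V → V → Prop} {u v : V}
    (huv : r u v) (hle : ∀ a b, r' a b → r a b) (σ : V ≃ V)
    (hσ : ∀ x y, (r x y ∧ ¬ (x = u ∧ y = v)) ↔ r' (σ x) (σ y)) :
    ∃ p q, r p q ∧ ∀ a b, r' a b ↔ r a b ∧ ¬ (a = p ∧ b = q) := by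
  classical
  let R : Finset (V × V) := Finset.univ.filter fun x => r x.1 x.2
  let R' : Finset (V × V) := Finset.univ.filter fun x => r' x.1 x.2
  have hsub : R' ⊆ R := by
    intro x hx
    simp only [R, R', Finset.mem_filter, Finset.mem_univ, true_and] at hx ⊢
    exact hle _ _ hx
  have hcard : R'.card = (R.erase (u, v)).card := by
    symm
    refine Finset.card_equiv (σ.prodCongr σ) fun x => ?_
    simp only [R, R', Finset.mem_filter, Finset.mem_univ, true_and, Finset.mem_erase,
      Equiv.prodCongr_apply, Prod.map_fst, Prod.map_snd, ← hσ, ne_eq, Prod.ext_iff]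
    exact and_comm
  have hmem : (u, v) ∈ R := by simp [R, huv]
  have hdiff : (R \ R').card = 1 := by
    have := Finset.card_erase_add_one hmem
    rw [Finset.card_sdiff_of_subset hsub]
    omega
  obtain ⟨⟨p, q⟩, hpq⟩ := Finset.card_eq_one.1 hdiff
  have hx (a b : V) : (r a b ∧ ¬ r' a b) ↔ (a = p ∧ b = q) := by
    have := Finset.ext_iff.1 hpq (a, b)
    simpa [R, R'] using this
  refine ⟨p, q, ((hx p q).2 ⟨rfl, rfl⟩).1, fun a b => ?_⟩
  have h1 := hx a b
  have h2 := hle a b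
  tauto

theorem Subalgebra.mem_map_innerAut {k B : Type*} [Field k] [Ring B] [Algebra k B] (c : Bˣ)
    (A : Subalgebra k B) (x : B) :
    x ∈ A.map (innerAut k c : B →ₐ[k] B) ↔ ↑c⁻¹ * x * c ∈ A := by
  constructor
  · rintro ⟨y, hy, rfl⟩
    change ↑c⁻¹ * (c * y * ↑c⁻¹) * c ∈ A
    simpa [mul_assoc] using hy
  · intro hx
    refine ⟨_, hx, ?_⟩
    change c * (↑c⁻¹ * x * c) * ↑c⁻¹ = x
    simp [mul_assoc]

/-! ### Subalgebras of an incidence algebra. -/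

namespace IsIncidenceRep

variable {k V B : Type*} [Field k] [Fintype V] [DecidableEq V] [Ring B] [Algebra k B]
  {r : V → V → Prop} {Φ : B →ₐ[k] Matrix V V k}

theorem cut (h : IsIncidenceRep r Φ) {u v : V} {A : Subalgebra k B}
    (hA : ∀ x, x ∈ A ↔ Φ x u v = 0) :
    IsIncidenceRep (fun x y => r x y ∧ ¬ (x = u ∧ y = v)) (Φ.comp A.val) where
  inj := h.inj.comp Subtype.val_injective
  supp x a b hab := ⟨h.supp x a b hab, by
    rintro ⟨rfl, rfl⟩
    exact hab ((hA x).1 x.2)⟩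
  exists_single a b hab := by
    obtain ⟨x, hx⟩ := h.exists_single a b hab.1
    exact ⟨⟨x, (hA x).2 (by rw [hx, Matrix.single_apply, if_neg hab.2])⟩, hx⟩

/-- A subalgebra with all the standard idempotents is an incidence algebra. -/
theorem of_subalgebra (h : IsIncidenceRep r Φ) {E : V → B}
    (hE : ∀ v, Φ (E v) = Matrix.single v v 1) {A : Subalgebra k B} (hA : ∀ v, E v ∈ A) :
    IsIncidenceRep (fun a b => ∃ x ∈ A, Φ x = Matrix.single a b 1) (Φ.comp A.val) where
  inj := h.inj.comp Subtype.val_injective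
  supp x a b hab := by
    have hab : Φ x a b ≠ 0 := hab
    refine ⟨(Φ x a b)⁻¹ • (E a * x * E b),
      A.smul_mem (A.mul_mem (A.mul_mem (hA a) x.2) (hA b)) _, ?_⟩
    rw [map_smul, map_mul_mul hE, Matrix.smul_single, smul_eq_mul, inv_mul_cancel₀ hab]
  exists_single a b hab := by
    obtain ⟨x, hx, hx'⟩ := hab
    exact ⟨⟨x, hx⟩, hx'⟩

/-- Each piece `E a * x * E b` of the Peirce decomposition is a scalar multiple of one matrix unit.
-/
theorem mem_of_supp (h : IsIncidenceRep r Φ) {E : V → B}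
    (hE : ∀ v, Φ (E v) = Matrix.single v v 1) {A : Subalgebra k B} {x : B}
    (hx : ∀ a b, Φ x a b ≠ 0 → ∃ y ∈ A, Φ y = Matrix.single a b 1) : x ∈ A := by
  have hEc := h.completeOrthogonalIdempotents hE
  have hsum : x = ∑ a, ∑ b, E a * x * E b := by
    simp only [← Finset.mul_sum, ← Finset.sum_mul, hEc.complete, mul_one, one_mul]
  rw [hsum]
  refine A.sum_mem fun a _ => A.sum_mem fun b _ => ?_
  by_cases hab : Φ x a b = 0
  · have : E a * x * E b = 0 := h.inj (by rw [map_mul_mul hE, hab]; simp)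
    rw [this]
    exact A.zero_mem
  · obtain ⟨y, hy, hy'⟩ := hx a b hab
    have : E a * x * E b = Φ x a b • y := h.inj (by rw [map_mul_mul hE, map_smul, hy']; simp)
    rw [this]
    exact A.smul_mem hy _

/-- If no relation of `r` joins `S` with its complement, then the sum of the standard idempotents
over `S` is a central idempotent. -/
theorem not_separated (h : IsIncidenceRep r Φ) [Std.Refl r]
    (hc : HasTrivialCentralIdempotents B) (S : V → Prop) (hS : ∀ a b, r a b → (S a ↔ S b))
    {a b : V} (ha : S a) (hb : ¬ S b) : False := by
  classical
  obtain ⟨ε, hε⟩ := (h.mem_range_iff (Matrix.diagonal fun v => if S v then 1 else 0)).2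
    fun x y hxy => by
      by_cases e : x = y
      · rw [e]; exact refl y
      · exact (hxy (Matrix.diagonal_apply_ne _ e)).elim
  have hε : Φ ε = Matrix.diagonal fun v => if S v then 1 else 0 := hε
  have h1 : IsIdempotentElem ε := h.inj (by simp [hε, Matrix.diagonal_mul_diagonal])
  have h2 (x : B) : ε * x = x * ε := by
    apply h.inj
    rw [map_mul, map_mul, hε]
    ext i j
    rw [Matrix.diagonal_mul, Matrix.mul_diagonal]
    by_cases e : Φ x i j = 0
    · simp [e]
    · simp [hS i j (h.supp x i j e)]
  rcases hc ε h1 h2 with e | e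
  · have := congrFun (congrFun hε a) a
    simp [e, ha] at this
  · have := congrFun (congrFun hε b) b
    simp [e, hb] at this

/-- If `u` is minimal and `v` maximal, `(u, v)` is the only relation crossing the edge between them.
Deleting it separates the two sides of the line, against `not_separated`. -/
theorem cut_connected {lt : V → V → Prop} {pos : V → ℤ} {m : ℤ} (ho : IsPathOrder lt pos m)
    (h : IsIncidenceRep (fun x y => x = y ∨ lt x y) Φ) {u v : V} (huv : lt u v)
    (hcov : ∀ z, ¬ (lt u z ∧ lt z v)) {A : Subalgebra k B} (hA : ∀ x, x ∈ A ↔ Φ x u v = 0)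
    (hc : HasTrivialCentralIdempotents A) :
    (∃ a, lt a u) ∨ ∃ b, lt v b := by
  by_contra hcon
  push Not at hcon
  obtain ⟨hu, hv⟩ := hcon
  have huv' : u ≠ v := fun e => hu u (e ▸ huv)
  -- Stated for an arbitrary coordinate, so that the reversed one handles `v` to the left of `u`.
  have sep {pos' : V → ℤ} (ho : IsPathOrder lt pos' m) (hlt : pos' u < pos' v) : False := by
    have : Std.Refl fun x y : V => (x = y ∨ lt x y) ∧ ¬ (x = u ∧ y = v) :=
      ⟨fun x => ⟨Or.inl rfl, fun e => huv' (e.1.symm.trans e.2)⟩⟩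
    refine (h.cut hA).not_separated hc (fun x => pos' x ≤ pos' u) ?_ (le_refl (pos' u))
      (not_le.2 hlt)
    have adj : pos' v = pos' u + 1 := by
      have := ho.adj_of_cover huv hcov
      omega
    rintro x y ⟨rfl | hxy, hn⟩
    · rfl
    have out {x y : V} (hx : pos' x ≤ pos' u) (hy : ¬ pos' y ≤ pos' u) :
        (lt x y → x = u ∧ y = v) ∧ ¬ lt y x := by
      constructor
      · intro l
        constructor
        · by_contra e
          have : pos' x ≠ pos' u := fun k => e (ho.inj k)
          exact hu x (ho.conv l (by omega)).1
        · by_contra e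
          have : pos' y ≠ pos' v := fun k => e (ho.inj k)
          exact hv y (ho.conv l (by omega)).2
      · intro l
        by_cases e : x = u
        · exact hu y (e ▸ l)
        · have : pos' x ≠ pos' u := fun k => e (ho.inj k)
          exact hu y (ho.conv l (by omega)).1
    by_cases hx : pos' x ≤ pos' u <;> by_cases hy : pos' y ≤ pos' u
    · simp [hx, hy]
    · exact (hn ((out hx hy).1 hxy)).elim
    · exact ((out hy hx).2 hxy).elim
    · simp [hx, hy]
  have hne : pos u ≠ pos v := fun e => huv' (ho.inj e)
  rcases lt_or_gt_of_ne hne with e | e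
  · exact sep ho e
  · exact sep ho.rev (by omega)

/-- A subalgebra of the incidence algebra of a path order that is isomorphic to a connected
incidence algebra of the order with one arrow cut out is carried to the latter by an
automorphism. -/
theorem exists_aut_of_equiv {lt : V → V → Prop} {pos : V → ℤ} {m : ℤ} (ho : IsPathOrder lt pos m)
    (h : IsIncidenceRep (fun x y => x = y ∨ lt x y) Φ) {u v : V} (huv : lt u v)
    (hcov : ∀ z, ¬ (lt u z ∧ lt z v)) {A A' : Subalgebra k B} (hA : ∀ x, x ∈ A ↔ Φ x u v = 0)
    (hc : HasTrivialCentralIdempotents A) (ψ : A ≃ₐ[k] A') :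
    ∃ φ : B ≃ₐ[k] B, A' = A.map (φ : B →ₐ[k] B) := by
  classical
  have po := ho.isPartialOrder
  have huv' : u ≠ v := fun e => ho.irrefl u (by rwa [← e] at huv)
  choose E hE using fun v => h.exists_single v v (Or.inl rfl)
  have hEA (w : V) : E w ∈ A := by
    rw [hA, hE, Matrix.single_apply, if_neg]
    exact fun e => huv' (e.1.symm.trans e.2)
  have hEA' : CompleteOrthogonalIdempotents fun w => (⟨E w, hEA w⟩ : A) :=
    (h.cut hA).completeOrthogonalIdempotents hE
  -- Conjugate so that the transported idempotents become the standard ones.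
  obtain ⟨c, s, hs⟩ := h.exists_conj hE (hEA'.map ((A'.val.comp (ψ : A →ₐ[k] A') : A →+* B)))
    (fun w e => idempotent_ne_zero hE w (by
      have : ψ ⟨E w, hEA w⟩ = 0 := Subtype.val_injective e
      rw [map_eq_zero_iff ψ ψ.injective] at this
      exact congrArg Subtype.val this)) rfl
  set C := A'.map (innerAut k c : B →ₐ[k] B) with hC
  have hEC (w : V) : E w ∈ C := by
    obtain ⟨w, rfl⟩ := s.surjective w
    rw [hC, Subalgebra.mem_map_innerAut, mul_assoc, ← hs, Units.inv_mul_cancel_left]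
    exact (ψ ⟨E w, hEA w⟩).2
  let χ : A ≃ₐ[k] C := ψ.trans (AlgEquiv.subalgebraMap (innerAut k c) A')
  have hrep := h.of_subalgebra hE hEC
  set r' : V → V → Prop := fun a b => ∃ x ∈ C, Φ x = Matrix.single a b 1 with hr'
  have r'_le {a b : V} (hab : r' a b) : a = b ∨ lt a b := by
    obtain ⟨x, -, hx⟩ := hab
    exact h.supp x a b (by rw [hx]; simp)
  have r'_trans {a b d : V} (h1 : r' a b) (h2 : r' b d) : r' a d := by
    obtain ⟨x, hx, hx'⟩ := h1
    obtain ⟨y, hy, hy'⟩ := h2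
    exact ⟨x * y, C.mul_mem hx hy, by rw [map_mul, hx', hy']; simp⟩
  have r'_refl (a : V) : r' a a := ⟨E a, hEC a, hE a⟩
  have : IsPartialOrder V r' :=
    { refl := r'_refl
      trans := fun _ _ _ => r'_trans
      antisymm := fun a b h1 h2 => po.antisymm a b (r'_le h1) (r'_le h2) }
  have : Std.Refl fun x y : V => (x = y ∨ lt x y) ∧ ¬ (x = u ∧ y = v) :=
    ⟨fun x => ⟨Or.inl rfl, fun e => huv' (e.1.symm.trans e.2)⟩⟩
  obtain ⟨σ, hσ⟩ := (h.cut hA).exists_equiv hrep χ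
  obtain ⟨p, q, hpq, hr⟩ := exists_missing_pair (r := fun x y => x = y ∨ lt x y)
    (Or.inr huv) (fun a b => r'_le) σ hσ
  have hpq : lt p q := hpq.resolve_left fun e => ((hr p q).1 (e ▸ r'_refl p)).2 ⟨rfl, rfl⟩
  have hCiff (x : B) : x ∈ C ↔ Φ x p q = 0 := by
    constructor
    · intro hx
      by_contra hne
      exact ((hr p q).1 (hrep.supp ⟨x, hx⟩ p q hne)).2 ⟨rfl, rfl⟩
    · intro hx
      refine h.mem_of_supp hE fun a b hab => (hr a b).2 ⟨h.supp x a b hab, ?_⟩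
      rintro ⟨rfl, rfl⟩
      exact hab hx
  -- An element strictly between `p` and `q` would put the missing pair into the transitive relation
  -- `r'`.
  have hcovpq (z : V) : ¬ (lt p z ∧ lt z q) := by
    rintro ⟨h1, h2⟩
    refine ((hr p q).1 (r'_trans ((hr p z).2 ⟨Or.inr h1, ?_⟩) ((hr z q).2 ⟨Or.inr h2, ?_⟩))).2
      ⟨rfl, rfl⟩
    · exact fun e => ho.irrefl q (by simpa [e.2] using h2)
    · exact fun e => ho.irrefl p (by simpa [e.1] using h1)
  have hpq' : p ≠ q := fun e => ho.irrefl p (by rwa [← e] at hpq)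
  have hcut (x y : V) : cutRel lt u v x y ↔ cutRel lt p q (σ x) (σ y) := by
    by_cases e : x = y
    · subst e
      simp [cutRel, ho.irrefl]
    · have := hσ x y
      rw [hr] at this
      simpa [e, cutRel] using this
  obtain ⟨τ, hτ, hτu, hτv⟩ := ho.exists_aut_of_cut_iso huv hcov (h.cut_connected ho huv hcov hA hc)
    hpq hcovpq (h.cut_connected ho hpq hcovpq hCiff (hc.of_equiv χ)) σ hcut
  obtain ⟨φ, hφ⟩ := h.exists_algEquiv τ (fun x y => by rw [τ.injective.eq_iff, ← hτ])
  -- `φ` carries `A` to the conjugate `C`; the inverse conjugation returns to `A'`.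
  refine ⟨φ.trans (innerAut k c).symm, ?_⟩
  ext x
  have hx : x ∈ A' ↔ innerAut k c x ∈ C := by
    rw [hC, Subalgebra.mem_map_innerAut]
    change x ∈ A' ↔ ↑c⁻¹ * (c * x * ↑c⁻¹) * c ∈ A'
    simp [mul_assoc]
  rw [hx, hCiff]
  obtain ⟨y, hy⟩ := φ.surjective (innerAut k c x)
  have hxy : (φ.trans (innerAut k c).symm) y = x := by
    rw [AlgEquiv.trans_apply, hy, AlgEquiv.symm_apply_apply]
  rw [← hy, ← hτu, ← hτv, hφ, ← hA, ← hxy]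
  exact (Function.Injective.mem_set_image (φ.trans (innerAut k c).symm).injective).symm

end IsIncidenceRep

/-! ### Path orders from type A quivers. -/

/-- The orientation `w` of the edges of a line (`w e` means that the edge from `e` to `e + 1`
points to the right) as a strict order on the vertices. -/
def lineOrder {V : Type*} (pos : V → ℤ) (w : ℤ → Prop) (x y : V) : Prop :=
  (pos x < pos y ∧ ∀ e, pos x ≤ e → e < pos y → w e) ∨
    (pos y < pos x ∧ ∀ e, pos y ≤ e → e < pos x → ¬ w e)

theorem isPathOrder_lineOrder {V : Type*} {pos : V → ℤ} {m : ℤ} (inj : Function.Injective pos)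
    (nonneg : ∀ x, 0 ≤ pos x) (le : ∀ x, pos x ≤ m)
    (surj : ∀ i, 0 ≤ i → i ≤ m → ∃ x, pos x = i) (w : ℤ → Prop) :
    IsPathOrder (lineOrder pos w) pos m := by
  have sep {x y z : V} (h1 : lineOrder pos w x z) (h2 : lineOrder pos w z y) :
      (pos x < pos z ∧ pos z < pos y) ∨ (pos y < pos z ∧ pos z < pos x) := by
    rcases h1 with h1 | h1 <;> rcases h2 with h2 | h2
    · exact Or.inl ⟨h1.1, h2.1⟩
    -- A turn at `z` would orient an edge next to `z` both ways.
    · exact (h2.2 (pos z - 1) (by omega) (by omega) (h1.2 _ (by omega) (by omega))).elim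
    · exact (h1.2 (pos z) (by omega) (by omega) (h2.2 _ (by omega) (by omega))).elim
    · exact Or.inr ⟨h2.1, h1.1⟩
  refine ⟨fun x => ?_, fun {x y z} h1 h2 => ?_, fun h => inj h, nonneg, le, surj,
    fun {x y} hxy => ?_, sep, fun {x y z} h hz => ?_⟩
  · simp [lineOrder]
  · have hs := sep h1 h2
    rcases h1 with h1 | h1 <;> rcases h2 with h2 | h2
    · refine Or.inl ⟨by omega, fun e he he' => ?_⟩
      rcases lt_or_ge e (pos y) with k | k
      exacts [h1.2 e he k, h2.2 e k he']
    · omega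
    · omega
    · refine Or.inr ⟨by omega, fun e he he' => ?_⟩
      rcases lt_or_ge e (pos y) with k | k
      exacts [h2.2 e he k, h1.2 e k he']
  · by_cases hw : w (pos x)
    · refine Or.inl (Or.inl ⟨by omega, fun e _ _ => ?_⟩)
      rwa [show e = pos x by omega]
    · refine Or.inr (Or.inr ⟨by omega, fun e _ _ => ?_⟩)
      rwa [show e = pos x by omega]
  · rcases h with h | h
    · exact ⟨Or.inl ⟨by omega, fun e _ _ => h.2 e (by omega) (by omega)⟩,
        Or.inl ⟨by omega, fun e _ _ => h.2 e (by omega) (by omega)⟩⟩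
    · exact ⟨Or.inr ⟨by omega, fun e _ _ => h.2 e (by omega) (by omega)⟩,
        Or.inr ⟨by omega, fun e _ _ => h.2 e (by omega) (by omega)⟩⟩

/-- A quiver without multiple arrows, whose arrows are exactly the comparable pairs of neighbours
of a path order on its vertices. -/
structure IsPathQuiver (V : Type*) [Quiver V] (lt : V → V → Prop) (pos : V → ℤ) (m : ℤ) :
    Prop extends IsPathOrder lt pos m where
  subsingleton_hom : ∀ a b : V, Subsingleton (a ⟶ b)
  lt_of_hom : ∀ {a b : V}, (a ⟶ b) → lt a b
  pos_of_hom : ∀ {a b : V}, (a ⟶ b) → pos b = pos a + 1 ∨ pos b = pos a - 1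
  hom_of_lt : ∀ {a b : V}, lt a b → (pos b = pos a + 1 ∨ pos b = pos a - 1) → Nonempty (a ⟶ b)

/-- The orientation `w` is read off from the arrows; uniqueness in the sum of the two hom types
excludes parallel and opposite arrows. The `n` vertices sit at `0, …, n - 1`, so `m = n - 1`. -/
theorem IsTypeA.exists_isPathQuiver {V : Type*} [Quiver V] (h : IsTypeA V) :
    ∃ lt pos m, IsPathQuiver V lt pos m := by
  obtain ⟨n, e, hn, h⟩ := h
  let pos : V → ℤ := fun v => ((e v : ℕ) : ℤ)
  have inj : Function.Injective pos := fun a b hab => e.injective (Fin.ext (by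
    simpa [pos] using hab))
  have hadj (a b : V) : (SimpleGraph.pathGraph n).Adj (e a) (e b) ↔
      (pos b = pos a + 1 ∨ pos b = pos a - 1) := by
    rw [SimpleGraph.pathGraph_adj]
    simp only [pos]
    omega
  have hom_pos {a b : V} (f : a ⟶ b) : pos b = pos a + 1 ∨ pos b = pos a - 1 := by
    rw [← hadj]
    by_contra hcon
    exact ((h a b).2 hcon).false f
  have sub {a b : V} (f : a ⟶ b) : Subsingleton ((a ⟶ b) ⊕ (b ⟶ a)) := by
    obtain ⟨u⟩ := (h a b).1 ((hadj a b).2 (hom_pos f))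
    infer_instance
  have asymm {a b : V} (f : a ⟶ b) (g : b ⟶ a) : False := by
    have := sub f
    exact Sum.inl_ne_inr (Subsingleton.elim (Sum.inl f) (Sum.inr g))
  have total {a b : V} (hab : pos b = pos a + 1 ∨ pos b = pos a - 1) :
      Nonempty (a ⟶ b) ∨ Nonempty (b ⟶ a) := by
    obtain ⟨u⟩ := (h a b).1 ((hadj a b).2 hab)
    rcases u.default with f | f
    exacts [Or.inl ⟨f⟩, Or.inr ⟨f⟩]
  let w : ℤ → Prop := fun i => ∃ x y : V, pos x = i ∧ pos y = i + 1 ∧ Nonempty (x ⟶ y)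
  have ho := isPathOrder_lineOrder (m := (n : ℤ) - 1) inj (fun x => by simp [pos])
    (fun x => by have := (e x).2; simp only [pos]; omega)
    (fun i h0 h1 => ⟨e.symm ⟨i.toNat, by omega⟩, by simp [pos, h0]⟩) w
  have lt_of_hom {a b : V} (f : a ⟶ b) : lineOrder pos w a b := by
    rcases hom_pos f with k | k
    · refine Or.inl ⟨by omega, fun i _ _ => ?_⟩
      exact ⟨a, b, by omega, by omega, ⟨f⟩⟩
    · refine Or.inr ⟨by omega, fun i _ _ => ?_⟩
      rintro ⟨x, y, hx, hy, ⟨g⟩⟩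
      rw [inj (show pos x = pos b by omega), inj (show pos y = pos a by omega)] at g
      exact asymm f g
  refine ⟨lineOrder pos w, pos, n - 1, ⟨ho, fun a b => ⟨fun f g => ?_⟩, lt_of_hom, hom_pos,
    fun {a b} hab hp => (total hp).resolve_right ?_⟩⟩
  · have := sub f
    exact Sum.inl_injective (Subsingleton.elim (Sum.inl f : (a ⟶ b) ⊕ (b ⟶ a)) (Sum.inl g))
  · rintro ⟨g⟩
    exact ho.asymm hab (lt_of_hom g)

namespace IsPathQuiver

variable {V : Type*} [Quiver V] {lt : V → V → Prop} {pos : V → ℤ} {m : ℤ}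

theorem eq_or_lt_of_path (h : IsPathQuiver V lt pos m) {a b : V} (p : Quiver.Path a b) :
    a = b ∨ lt a b := by
  induction p with
  | nil => exact Or.inl rfl
  | cons p f ih =>
    right
    rcases ih with rfl | ih
    · exact h.lt_of_hom f
    · exact h.trans ih (h.lt_of_hom f)

theorem lt_of_path_of_hom (h : IsPathQuiver V lt pos m) {a b c : V} (p : Quiver.Path a b)
    (f : b ⟶ c) : lt a c := by
  rcases h.eq_or_lt_of_path p with rfl | k
  · exact h.lt_of_hom f
  · exact h.trans k (h.lt_of_hom f)

theorem nonempty_path (h : IsPathQuiver V lt pos m) {a b : V} (hab : lt a b) :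
    Nonempty (Quiver.Path a b) := by
  induction hn : (pos b - pos a).natAbs using Nat.strong_induction_on generalizing a b with
  | _ n ih =>
    by_cases hc : ∃ z, lt a z ∧ lt z b
    · obtain ⟨z, h1, h2⟩ := hc
      have := h.between h1 h2
      obtain ⟨p⟩ := ih _ (by omega) h1 rfl
      obtain ⟨q⟩ := ih _ (by omega) h2 rfl
      exact ⟨p.comp q⟩
    · push Not at hc
      obtain ⟨f⟩ := h.hom_of_lt hab (h.adj_of_cover hab fun z hz => hc z hz.1 hz.2)
      exact ⟨f.toPath⟩

/-- If the last arrows of two paths to `c` came from different vertices, these would be the two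
neighbours of `c`, and `between` would place `a` inconsistently on the line. -/
theorem subsingleton_path (h : IsPathQuiver V lt pos m) (a b : V) :
    Subsingleton (Quiver.Path a b) := by
  refine ⟨fun p q => ?_⟩
  induction p with
  | nil =>
    cases q with
    | nil => rfl
    | cons q g => exact (h.irrefl _ (h.lt_of_path_of_hom q g)).elim
  | @cons b c p f ih =>
    cases q with
    | nil => exact (h.irrefl _ (h.lt_of_path_of_hom p f)).elim
    | @cons b' _ q g =>
      have hb : b = b' := by
        by_contra hne
        have n1 : pos b ≠ pos b' := fun e => hne (h.inj e)
        have p1 := h.pos_of_hom f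
        have p2 := h.pos_of_hom g
        rcases h.eq_or_lt_of_path p with rfl | k1
        · have := h.between ((h.eq_or_lt_of_path q).resolve_left hne) (h.lt_of_hom g)
          omega
        · rcases h.eq_or_lt_of_path q with rfl | k2
          · have := h.between k1 (h.lt_of_hom f)
            omega
          · have := h.between k1 (h.lt_of_hom f)
            have := h.between k2 (h.lt_of_hom g)
            omega
      subst hb
      have := h.subsingleton_hom b c
      rw [ih q, Subsingleton.elim f g]

end IsPathQuiver

/-! ### The path algebra as an incidence algebra. -/

namespace PathAlgebra

/-- Paths of length zero, one and at least two fall into `kQ₀`, an arrow span other than that of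
`(u, v)`, and `J(Q)²`. -/
theorem ofPath_mem_splitSubmodule {k V : Type*} [Field k] [Quiver V] [Fintype V] {a b u v : V}
    (p : Quiver.Path a b) (hab : ¬ (a = u ∧ b = v))
    (U : Submodule k (PathAlgebra k V)) : ofPath ⟨a, b, p⟩ ∈ splitSubmodule u v U := by
  have arrow_mem {x y : V} (f : x ⟶ y) : (arrow f : PathAlgebra k V) ∈ arrowSpan k x y :=
    Submodule.subset_span ⟨f, rfl⟩
  cases p with
  | nil =>
    exact Submodule.mem_sup_left (Submodule.mem_sup_left (Submodule.mem_sup_left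
      (Submodule.subset_span ⟨a, rfl⟩)))
  | @cons c _ p f =>
    cases p with
    | nil =>
      refine Submodule.mem_sup_left (Submodule.mem_sup_right ?_)
      exact Submodule.mem_iSup_of_mem a (Submodule.mem_iSup_of_mem b
        (Submodule.mem_iSup_of_mem (by simpa using hab) (arrow_mem f)))
    | @cons d _ p g =>
      refine Submodule.mem_sup_right ?_
      have e1 : (ofPath ⟨a, b, (p.cons g).cons f⟩ : PathAlgebra k V) =
          ofPath ⟨a, c, p.cons g⟩ * arrow f := (ofPath_mul_ofPath_of_comp _ f.toPath).symm
      have e2 : (ofPath ⟨a, c, p.cons g⟩ : PathAlgebra k V) = ofPath ⟨a, d, p⟩ * arrow g :=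
        (ofPath_mul_ofPath_of_comp _ g.toPath).symm
      rw [e1, e2, pow_two]
      refine Submodule.mul_mem_mul (top_mul_arrowIdeal (Submodule.mul_mem_mul
        Submodule.mem_top ?_)) ?_
      all_goals exact arrowSpan_le_arrowIdeal _ _ (arrow_mem _)

variable (k : Type*) [Field k] (V : Type*) [Quiver V] [Fintype V] [DecidableEq V]

/-- The matrix representation of the path algebra that sends a path from `a` to `b` to the matrix
unit at `(a, b)`. -/
noncomputable def toMatrix : PathAlgebra k V →ₐ[k] Matrix V V k :=
  AlgHom.ofLinearMap (liftPaths fun p => Matrix.single p.1 p.2.1 1)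
    (by simp only [one_def, map_sum, vertex, liftPaths_ofPath, Matrix.sum_single_one])
    (by
      intro x y
      induction x using induction_on with
      | zero => simp
      | add x x' hx hx' => simp only [add_mul, map_add, hx, hx']
      | smul c p =>
        induction y using induction_on with
        | zero => simp
        | add y y' hy hy' => simp only [mul_add, map_add, hy, hy']
        | smul d q =>
          simp only [smul_mul_assoc, mul_smul_comm, map_smul, liftPaths_ofPath]
          congr 2
          obtain ⟨a, b, p⟩ := p
          obtain ⟨b', c, q⟩ := q
          by_cases hb : b = b'
          · subst hb
            rw [ofPath_mul_ofPath_of_comp, liftPaths_ofPath]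
            simp
          · rw [ofPath_mul_ofPath_of_ne hb, map_zero, Matrix.single_mul_single_of_ne _ _ _ _ hb])

variable {k V}

theorem toMatrix_ofPath (p : AllPaths V) :
    toMatrix k V (ofPath p) = Matrix.single p.1 p.2.1 1 :=
  liftPaths_ofPath _ _

variable {lt : V → V → Prop} {pos : V → ℤ} {m : ℤ}

/-- A path is determined by its endpoints, so the basis of paths goes to distinct matrix units. -/
theorem isIncidenceRep_toMatrix (h : IsPathQuiver V lt pos m) :
    IsIncidenceRep (fun x y => x = y ∨ lt x y) (toMatrix k V) where
  inj := by
    have hi : Function.Injective fun p : AllPaths V => (p.1, p.2.1) := by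
      rintro ⟨a, b, p⟩ ⟨a', b', p'⟩ e
      obtain ⟨rfl, rfl⟩ := Prod.ext_iff.1 e
      have := h.subsingleton_path a b
      rw [Subsingleton.elim p p']
    have li := (Matrix.stdBasis k V V).linearIndependent.comp _ hi
    have e : (Matrix.stdBasis k V V) ∘ (fun p : AllPaths V => (p.1, p.2.1)) =
        fun p => Matrix.single p.1 p.2.1 1 := by
      ext1 p
      exact Matrix.stdBasis_eq_single (R := k) p.1 p.2.1
    rw [e] at li
    exact li
  supp x a b hab := by
    by_contra hcon
    apply hab
    induction x using induction_on with
    | zero => simp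
    | add x y hx hy =>
      by_cases h0 : toMatrix k V x a b = 0 <;> by_cases h1 : toMatrix k V y a b = 0
      · simp [h0, h1]
      · exact absurd (hy h1) h1
      · exact absurd (hx h0) h0
      · exact absurd (hy h1) h1
    | smul c p =>
      rw [map_smul, toMatrix_ofPath, Matrix.smul_apply, Matrix.single_apply, if_neg, smul_zero]
      rintro ⟨rfl, rfl⟩
      exact hcon (h.eq_or_lt_of_path p.2.2)
  exists_single a b hab := by
    have : Nonempty (Quiver.Path a b) := by
      rcases hab with rfl | hab
      · exact ⟨.nil⟩
      · exact h.nonempty_path hab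
    obtain ⟨p⟩ := this
    exact ⟨ofPath ⟨a, b, p⟩, toMatrix_ofPath _⟩

/-- The elements whose matrix is supported on the strict order. -/
noncomputable def strictPart (k : Type*) [Field k] (lt : V → V → Prop) :
    Submodule k (PathAlgebra k V) where
  carrier := {x | ∀ a b, ¬ lt a b → toMatrix k V x a b = 0}
  zero_mem' := by simp
  add_mem' hx hy a b hab := by simp [hx a b hab, hy a b hab]
  smul_mem' c x hx a b hab := by simp [hx a b hab]

theorem arrowIdeal_le_strictPart (h : IsPathQuiver V lt pos m) :
    arrowIdeal k V ≤ strictPart k lt := by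
  have hr := isIncidenceRep_toMatrix (k := k) h
  have h1 : (⨆ (u : V) (v : V), arrowSpan k u v) ≤ strictPart k lt := by
    refine iSup_le fun u => iSup_le fun v => Submodule.span_le.2 ?_
    rintro _ ⟨f, rfl⟩ a b hab
    change toMatrix k V (ofPath _) a b = 0
    rw [toMatrix_ofPath, Matrix.single_apply, if_neg]
    rintro ⟨rfl, rfl⟩
    exact hab (h.lt_of_hom f)
  refine Submodule.mul_le.2 fun x hx y _ a b hab => ?_
  have hx : x ∈ strictPart k lt := by
    refine (Submodule.mul_le.2 fun x _ y hy a b hab => ?_) hx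
    rw [map_mul, Matrix.mul_apply]
    refine Finset.sum_eq_zero fun c _ => ?_
    by_contra hne
    rcases hr.supp x a c (left_ne_zero_of_mul hne) with rfl | k1
    · exact right_ne_zero_of_mul hne (h1 hy _ _ hab)
    · exact right_ne_zero_of_mul hne (h1 hy _ _ fun k2 => hab (h.trans k1 k2))
  rw [map_mul, Matrix.mul_apply]
  refine Finset.sum_eq_zero fun c _ => ?_
  by_contra hne
  rcases hr.supp y c b (right_ne_zero_of_mul hne) with rfl | k1
  · exact left_ne_zero_of_mul hne (hx _ _ hab)
  · exact left_ne_zero_of_mul hne (hx _ _ fun k2 => hab (h.trans k2 k1))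

/-- A nonzero `(u, v)` entry of an element of `J(Q)²` would need a vertex strictly between the
neighbours `u` and `v`. Conversely, every path with other endpoints lies in the subalgebra. -/
theorem mem_splitSubalgebra_iff (h : IsPathQuiver V lt pos m) {u v : V} (f : u ⟶ v)
    {U : Submodule k (PathAlgebra k V)} (hU : U ≤ arrowSpan k u v)
    (hcodim : Module.finrank k U + 1 = Module.finrank k (arrowSpan k u v))
    (x : PathAlgebra k V) : x ∈ splitSubalgebra u v U hU ↔ toMatrix k V x u v = 0 := by
  have hr := isIncidenceRep_toMatrix (k := k) h
  have hlt := h.lt_of_hom f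
  have hne : u ≠ v := fun e => h.irrefl u (by rwa [← e] at hlt)
  have := h.subsingleton_hom u v
  have hspan : arrowSpan k u v = Submodule.span k {arrow f} := by
    rw [arrowSpan]
    congr 1
    ext y
    constructor
    · rintro ⟨g, rfl⟩
      rw [Subsingleton.elim g f]
      rfl
    · rintro rfl
      exact ⟨f, rfl⟩
  -- The arrow span is a line, so codimension one leaves nothing.
  have hU0 : U = ⊥ := by
    have : Module.Finite k (arrowSpan k u v) := by rw [hspan]; infer_instance
    have : Module.Finite k U := Submodule.finiteDimensional_of_le hU
    have := finrank_span_singleton (K := k) (v := (arrow f : PathAlgebra k V)) (fun e => by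
      have := congrFun (congrFun (toMatrix_ofPath (k := k) ⟨u, v, f.toPath⟩) u) v
      change toMatrix k V (arrow f) u v = _ at this
      simp [e] at this)
    rw [hspan] at hcodim
    exact Submodule.finrank_eq_zero.1 (by omega)
  subst hU0
  constructor
  · let K : Submodule k (PathAlgebra k V) :=
      LinearMap.ker (Matrix.entryLinearMap k k u v ∘ₗ (toMatrix k V).toLinearMap)
    have memK (y : PathAlgebra k V) : y ∈ K ↔ toMatrix k V y u v = 0 := Iff.rfl
    suffices hle : splitSubmodule u v ⊥ ≤ K from fun hx => hle hx
    refine sup_le (sup_le (sup_le (Submodule.span_le.2 ?_) bot_le) ?_) ?_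
    · rintro _ ⟨a, rfl⟩
      rw [SetLike.mem_coe, memK, vertex, toMatrix_ofPath, Matrix.single_apply, if_neg]
      exact fun e => hne (e.1.symm.trans e.2)
    · refine iSup_le fun a => iSup_le fun b => iSup_le fun hab => Submodule.span_le.2 ?_
      rintro _ ⟨g, rfl⟩
      change toMatrix k V (ofPath _) u v = 0
      rw [toMatrix_ofPath, Matrix.single_apply, if_neg]
      rintro ⟨rfl, rfl⟩
      exact hab rfl
    · rw [pow_two]
      refine Submodule.mul_le.2 fun y hy z hz => ?_
      rw [memK, map_mul, Matrix.mul_apply]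
      refine Finset.sum_eq_zero fun c _ => ?_
      by_contra hne
      have k1 : lt u c := by
        by_contra k
        exact left_ne_zero_of_mul hne (arrowIdeal_le_strictPart h hy _ _ k)
      have k2 : lt c v := by
        by_contra k
        exact right_ne_zero_of_mul hne (arrowIdeal_le_strictPart h hz _ _ k)
      exact h.not_mid k1 k2 (h.pos_of_hom f)
  · intro hx
    refine hr.mem_of_supp (E := vertex) (fun w => toMatrix_ofPath _) fun a b hab => ?_
    obtain ⟨p⟩ : Nonempty (Quiver.Path a b) := by
      rcases hr.supp x a b hab with rfl | k
      · exact ⟨.nil⟩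
      · exact h.nonempty_path k
    refine ⟨ofPath ⟨a, b, p⟩, ofPath_mem_splitSubmodule p ?_ _, toMatrix_ofPath _⟩
    rintro ⟨rfl, rfl⟩
    exact hab hx

end PathAlgebra

/-! ### The two inclusions. -/

theorem autOrbit_subset_isoClass {k B : Type*} [Field k] [Ring B] [Algebra k B]
    (A : Subalgebra k B) : autOrbit A ⊆ isoClass A := by
  rintro _ ⟨φ, rfl⟩
  exact ⟨(AlgEquiv.subalgebraMap φ A).toLinearEquiv.finrank_eq.symm,
    ⟨AlgEquiv.subalgebraMap φ A⟩⟩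

theorem proposition4p5 {k : Type*} [Field k] [IsAlgClosed k] {V : Type*} [Quiver V] [Fintype V]
    (hQ : IsTypeA V) (A : Subalgebra k (PathAlgebra k V)) (hmax : IsCoatom A)
    (hsplit : IsSplitType A) (hconn : HasConnectedExtQuiver k A) :
    isoClass A = autOrbit A := by
  classical
  refine Set.Subset.antisymm ?_ (autOrbit_subset_isoClass A)
  rintro A' ⟨-, ⟨ψ⟩⟩
  obtain ⟨lt, pos, m, h⟩ := hQ.exists_isPathQuiver
  obtain ⟨u, v, U, hU, c, ⟨f⟩, hcodim, -, hA⟩ := hsplit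
  let χ : A ≃ₐ[k] PathAlgebra.splitSubalgebra u v U hU :=
    (AlgEquiv.subalgebraMap (innerAut k c) A).trans (Subalgebra.equivOfEq _ _ hA)
  obtain ⟨φ, hφ⟩ := (PathAlgebra.isIncidenceRep_toMatrix (k := k) h).exists_aut_of_equiv
    h.toIsPathOrder (h.lt_of_hom f) (fun z hz => h.not_mid hz.1 hz.2 (h.pos_of_hom f))
    (PathAlgebra.mem_splitSubalgebra_iff h f hU hcodim)
    (hconn.hasTrivialCentralIdempotents.of_equiv χ) (χ.symm.trans ψ)
  -- `φ` starts from `A(u,v,U)`, which the conjugation by `c` reaches from `A`.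
  refine ⟨(innerAut k c).trans φ, ?_⟩
  rw [hφ, ← hA, Subalgebra.map_map]
  rfl
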